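/- Fix $\alpha\in(-\tfrac{18}{7},-\tfrac52)$ and $\delta_0$ with $4\alpha+10<-\delta_0<0$ and $2\delta_0\neq 3\alpha+8$. For $k\in\mathbb N^4$ put $|k|_{\mathfrak s}=2k_0+k_1+k_2+k_3$. Let $\mathcal F^1$ be the set of formal expressions generated by $\mathbf 1,\Xi,X_0,\dots,X_3,\mathbf C_1,\mathbf C_2$ under a commutative, associative product with unit $\mathbf 1$ and under maps $\tau\mapsto\mathcal I_k(\tau)$, $k\in\mathbb N^4$ ($\mathcal I=\mathcal I_0$), with homogeneity $|\mathbf 1|=0$, $|\Xi|=\alpha$, $|X_0|=2$, $|X_1|=|X_2|=|X_3|=1$, $|\mathbf C_1|=|\mathbf C_2|=-\delta_0$, $|\tau\bar\tau|=|\tau|+|\bar\tau|$, $|\mathcal I_k\tau|=|\tau|+2-|k|_{\mathfrak s}$. Let $\mathcal F^1_+$ be the set of $\tau\in\mathcal F^1$ such that $\tau=\mathbf 1$ or $|\tau|>0$, and such that whenever $\tau=\tau_1\tau_2$, each $\tau_i$ satisfies $\tau_i=\mathbf 1$ or $|\tau_i|>0$. Let $\mathcal H^1,\mathcal H^1_+$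 be the real vector spaces with bases $\mathcal F^1,\mathcal F^1_+$, and let $P_+:\mathcal H^1\to\mathcal H^1_+$ be the identity on $\mathcal F^1_+$ and $0$ on $\mathcal F^1\setminus\mathcal F^1_+$. Let $\Delta:\mathcal H^1\to\mathcal H^1\otimes\mathcal H^1_+$ be the linear multiplicative map with $\Delta\mathbf 1=\mathbf 1\otimes\mathbf 1$, $\Delta\Xi=\Xi\otimes\mathbf 1$, $\Delta\mathbf C_j=\mathbf C_j\otimes\mathbf 1$, $\Delta X_i=X_i\otimes\mathbf 1+\mathbf 1\otimes X_i$ and $$\Delta(\mathcal I_k\tau)=(\mathcal I_k\otimes I)\Delta\tau+\sum_{l,m\in\mathbb N^4}\frac{X^l}{l!}\otimes\frac{X^m}{m!}\,P_+\mathcal I_{k+l+m}\tau .$$ For each multiplicative unital linear functional $g:\mathcal H^1_+\to\mathbb R$ let $\Gamma_g=(I\otimes g)\Delta:\mathcal H^1\to\mathcal H^1$. Let $\mathcal W_0=\mathcal U_0=\emptyset$ and, for $n\ge1$, let $\mathcal W_n$ be the union of $\mathcal W_{n-1}$, $\{\Xi\}$ and the set of all products of at most three (possibly zero) elements of $\mathcal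 U_{n-1}$, and $\mathcal U_n=\{X^k:k\in\mathbb N^4\}\cup\{\mathbf C_1,\mathbf C_2\}\cup\{\mathcal I(\tau):\tau\in\mathcal W_n\}$. Put $\mathcal F^1_F=\bigcup_n(\mathcal W_n\cup\mathcal U_n)$, let $\mathcal H^1_F$ be its linear span, $A^1=\{|\tau|:\tau\in\mathcal F^1_F\}$, and $T_\gamma=\langle\{\tau\in\mathcal F^1_F:|\tau|=\gamma\}\rangle$ for $\gamma\in A^1$. **Theorem 3.1.** Every $\Gamma_g$ maps $\mathcal H^1_F$ into itself, each $T_\gamma$ is finite-dimensional (and is given the $\ell^1$ norm of coefficients, say), and with $G^1_F=\{\Gamma_g|_{\mathcal H^1_F}\}$ the triple $\mathfrak T^1=(A^1,\mathcal H^1_F,G^1_F)$ is a regularity structure, that is: (i) $A^1\subset\mathbb R$ contains $0$, is bounded below and is locally finite; (ii) $\mathcal H^1_F=\bigoplus_{\gamma\in A^1}T_\gamma$, each $T_\gamma$ is a Banach space, and $T_0$ is one-dimensional with basis vector $\mathbf 1$; (iii) $G^1_F$ is a group, under composition, of continuous linear operators on $\mathcal H^1_F$ (for all $\gamma,\beta\in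 A^1$ the map from $T_\gamma$ to the $T_\beta$-component is bounded), and for all $\Gamma\in G^1_F$ one has $\Gamma\mathbf 1=\mathbf 1$ and $\Gamma\tau-\tau\in\bigoplus_{\beta<\gamma}T_\beta$ for all $\gamma\in A^1$, $\tau\in T_\gamma$. -/

import Mathlib

open scoped TensorProduct

noncomputable section

/-! ### Regularity structures -/

/-- The component in `T β` of a vector of an internal direct sum `V = ⨁ T β`. -/
def gradedComponent {V : Type*} [AddCommGroup V] [Module ℝ V] {A : Set ℝ}
    {T : A → Submodule ℝ V}
    (h : letI := Classical.decEq A; DirectSum.IsInternal T) (β : A) : V →ₗ[ℝ] T β :=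
  letI := Classical.decEq A
  (DirectSum.component ℝ A (fun γ => T γ) β) ∘ₗ
    ((LinearEquiv.ofBijective (DirectSum.coeLinearMap T) h).symm : V →ₗ[ℝ] DirectSum A fun γ => T γ)

/-- `(A, T, G)` is a regularity structure, where the model space is `V = ⨁_{γ ∈ A} T γ`,
`T γ` is a Banach space for the norm `N γ`, and `T 0` has the basis vector `one`. -/
structure IsRegularityStructure {V : Type*} [AddCommGroup V] [Module ℝ V]
    (A : Set ℝ) (T : A → Submodule ℝ V) (N : ∀ γ : A, Seminorm ℝ (T γ)) (one : V)
    (G : Set (Module.End ℝ V)) : Prop where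
  /- the index set -/
  zero_mem : (0 : ℝ) ∈ A
  bddBelow : BddBelow A
  locallyFinite : ∀ R : ℝ, (A ∩ Set.Icc (-R) R).Finite
  /- the graded model space -/
  internal : letI := Classical.decEq A; DirectSum.IsInternal T
  norm_definite : ∀ (γ : A) (x : T γ), N γ x = 0 → x = 0
  complete : ∀ (γ : A) (u : ℕ → T γ),
    (∀ ε > 0, ∃ n₀, ∀ m ≥ n₀, ∀ n ≥ n₀, N γ (u m - u n) < ε) →
      ∃ x : T γ, ∀ ε > 0, ∃ n₀, ∀ n ≥ n₀, N γ (u n - x) < ε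
  one_ne_zero : one ≠ 0
  span_one : T ⟨0, zero_mem⟩ = Submodule.span ℝ {one}
  /- the structure group: a group of continuous operators, lower triangular for the grading -/
  id_mem : (1 : Module.End ℝ V) ∈ G
  mul_mem : ∀ Φ ∈ G, ∀ Ψ ∈ G, Φ * Ψ ∈ G
  inv_mem : ∀ Φ ∈ G, ∃ Ψ ∈ G, Φ * Ψ = 1 ∧ Ψ * Φ = 1
  continuous : ∀ Φ ∈ G, ∀ γ β : A, ∃ K : ℝ, ∀ x : T γ,
    N β (gradedComponent internal β (Φ x)) ≤ K * N γ x
  triangular : ∀ Φ ∈ G, ∀ (γ : A) (x : T γ), Φ x - x ∈ ⨆ (β : A) (_ : β < γ), T β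
  map_one : ∀ Φ ∈ G, Φ one = one

namespace PhiFour

/-! ### Symbols -/

/-- Multi-indices in `ℕ⁴`; the index `0` is time. -/
abbrev MIdx := Fin 4 → ℕ

/-- The parabolic scaling `(2, 1, 1, 1)`. -/
def scaling : Fin 4 → ℕ := ![2, 1, 1, 1]

/-- The scaled degree `|k| = ∑ sᵢ kᵢ`. -/
def wt (k : MIdx) : ℕ := ∑ i, scaling i * k i

/-- `k! = ∏ kᵢ!`. -/
def mfact (k : MIdx) : ℝ := ∏ i, ((k i).factorial : ℝ)

/-- Formal expressions built from `1`, `Ξ`, `X_i`, `C_1`, `C_2`, products and the `I_k`. -/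
inductive PreSym : Type
  | one : PreSym
  | noise : PreSym
  | X (i : Fin 4) : PreSym
  | C (j : Fin 2) : PreSym
  | mul (a b : PreSym) : PreSym
  | int (k : MIdx) (a : PreSym) : PreSym

/-- The identifications making the product commutative and associative with unit `1`. -/
inductive PreSym.Rel : PreSym → PreSym → Prop
  | comm (a b : PreSym) : Rel (.mul a b) (.mul b a)
  | assoc (a b c : PreSym) : Rel (.mul (.mul a b) c) (.mul a (.mul b c))
  | one_mul (a : PreSym) : Rel (.mul .one a) a
  | mul_left {a a' : PreSym} (b : PreSym) : Rel a a' → Rel (.mul a b) (.mul a' b)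
  | mul_right (a : PreSym) {b b' : PreSym} : Rel b b' → Rel (.mul a b) (.mul a b')
  | int (k : MIdx) {a a' : PreSym} : Rel a a' → Rel (.int k a) (.int k a')

/-- The set of all symbols. -/
def Sym : Type := Quot PreSym.Rel

namespace Sym

/-- The symbol represented by a formal expression. -/
def mk (a : PreSym) : Sym := Quot.mk _ a

instance : CommMonoid Sym where
  mul := Quot.map₂ PreSym.mul (fun a _ _ h => .mul_right a h) (fun _ _ b h => .mul_left b h)
  one := mk .one
  mul_comm := by rintro ⟨a⟩ ⟨b⟩; exact Quot.sound (.comm a b)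
  mul_assoc := by rintro ⟨a⟩ ⟨b⟩ ⟨c⟩; exact Quot.sound (.assoc a b c)
  one_mul := by rintro ⟨a⟩; exact Quot.sound (.one_mul a)
  mul_one := by
    rintro ⟨a⟩
    exact (Quot.sound (.comm a .one)).trans (Quot.sound (.one_mul a))

/-- The noise symbol `Ξ`. -/
def noise : Sym := mk .noise
/-- The symbol `X_i`. -/
def X (i : Fin 4) : Sym := mk (.X i)
/-- The symbols `C_1`, `C_2`. -/
def C (j : Fin 2) : Sym := mk (.C j)
/-- The abstract integration `I_k`. -/
def int (k : MIdx) : Sym → Sym := Quot.map (PreSym.int k) fun _ _ h => .int k h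
/-- The monomial `X^k`. -/
def Xpow (k : MIdx) : Sym := ∏ i, X i ^ k i

lemma mk_mul (a b : PreSym) : mk (.mul a b) = mk a * mk b := rfl

end Sym

/-- The homogeneity of a formal expression. -/
def PreSym.deg (α δ₀ : ℝ) : PreSym → ℝ
  | .one => 0
  | .noise => α
  | .X i => scaling i
  | .C _ => -δ₀
  | .mul a b => a.deg α δ₀ + b.deg α δ₀
  | .int k a => a.deg α δ₀ + 2 - wt k

/-- The homogeneity of a symbol. -/
def Sym.deg (α δ₀ : ℝ) : Sym → ℝ :=
  Quot.lift (PreSym.deg α δ₀) (by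
    intro a b h
    induction h <;> simp_all [PreSym.deg, add_comm, add_assoc])

lemma Sym.deg_one (α δ₀ : ℝ) : Sym.deg α δ₀ 1 = 0 := rfl

lemma Sym.deg_mul (α δ₀ : ℝ) (a b : Sym) :
    Sym.deg α δ₀ (a * b) = Sym.deg α δ₀ a + Sym.deg α δ₀ b := by
  rcases a with ⟨a⟩; rcases b with ⟨b⟩; rfl

/-! Every symbol is a product of irreducible ones, in a unique way. -/

/-- The multiset of irreducible factors of a formal expression. -/
def PreSym.factors : PreSym → Multiset Sym
  | .one => 0
  | .mul a b => a.factors + b.factors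
  | .noise => {Sym.noise}
  | .X i => {Sym.X i}
  | .C j => {Sym.C j}
  | .int k a => {Sym.int k (Sym.mk a)}

/-- The multiset of irreducible factors of a symbol. -/
def Sym.factors : Sym → Multiset Sym :=
  Quot.lift PreSym.factors (by
    intro a b h
    induction h with
    | comm a b => simp [PreSym.factors, add_comm]
    | assoc a b c => simp [PreSym.factors, add_assoc]
    | one_mul a => simp [PreSym.factors]
    | mul_left b _ ih => simp [PreSym.factors, ih]
    | mul_right a _ ih => simp [PreSym.factors, ih]
    | int k h _ =>
      simp only [PreSym.factors]
      rw [show Sym.mk _ = Sym.mk _ from Quot.sound h])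

lemma Sym.factors_mul (a b : Sym) : (a * b).factors = a.factors + b.factors := by
  rcases a with ⟨a⟩; rcases b with ⟨b⟩; rfl

lemma Sym.prod_factors (a : Sym) : a.factors.prod = a := by
  rcases a with ⟨a⟩
  change a.factors.prod = Sym.mk a
  induction a with
  | one => rfl
  | mul a b iha ihb => simp [PreSym.factors, iha, ihb, Sym.mk_mul]
  | _ => (simp [PreSym.factors]; rfl)

lemma Sym.factors_of_mem {a p : Sym} (h : p ∈ a.factors) : p.factors = {p} := by
  rcases a with ⟨a⟩
  change p ∈ a.factors at h
  induction a with
  | one => simp [PreSym.factors] at h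
  | mul a b iha ihb =>
    rcases Multiset.mem_add.1 h with h | h
    · exact iha h
    · exact ihb h
  | _ => simp only [PreSym.factors, Multiset.mem_singleton] at h; subst h; rfl

/-- `τ = 1` or `|τ| > 0`. -/
def Sym.OneOrPos (α δ₀ : ℝ) (τ : Sym) : Prop := τ = 1 ∨ 0 < Sym.deg α δ₀ τ

lemma Sym.oneOrPos_of_factors (α δ₀ : ℝ) (τ : Sym)
    (h : ∀ p ∈ τ.factors, 0 < Sym.deg α δ₀ p) : τ.OneOrPos α δ₀ := by
  rw [← τ.prod_factors]
  generalize τ.factors = s at h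
  induction s using Multiset.induction_on with
  | empty => exact Or.inl rfl
  | cons p s ih =>
    right
    rw [Multiset.prod_cons, Sym.deg_mul]
    have hp := h p (Multiset.mem_cons_self p s)
    rcases ih fun q hq => h q (Multiset.mem_cons_of_mem hq) with h1 | h1
    · rw [h1, Sym.deg_one]; linarith
    · linarith

/-- The condition defining the symbols of positive type: `τ = 1` or `|τ| > 0`, and for every
factorisation `τ = τ₁ τ₂` one has `τᵢ = 1` or `|τᵢ| > 0`. -/
def Sym.IsPlus (α δ₀ : ℝ) (τ : Sym) : Prop :=
  τ.OneOrPos α δ₀ ∧ ∀ τ₁ τ₂ : Sym, τ = τ₁ * τ₂ → τ₁.OneOrPos α δ₀ ∧ τ₂.OneOrPos α δ₀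

lemma Sym.isPlus_iff (α δ₀ : ℝ) (τ : Sym) :
    τ.IsPlus α δ₀ ↔ ∀ p ∈ τ.factors, 0 < Sym.deg α δ₀ p := by
  constructor
  · rintro ⟨-, h⟩ p hp
    obtain ⟨s, hs⟩ := Multiset.exists_cons_of_mem hp
    have := (h p s.prod (by rw [← Multiset.prod_cons, ← hs, Sym.prod_factors])).1
    rcases this with h1 | h1
    · have h2 := Sym.factors_of_mem hp
      rw [h1] at h2
      exact absurd (congrArg Multiset.card h2) (by
        rw [show (1 : Sym).factors = 0 from rfl]; simp)
    · exact h1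
  · intro h
    refine ⟨Sym.oneOrPos_of_factors α δ₀ τ h, ?_⟩
    rintro τ₁ τ₂ rfl
    rw [Sym.factors_mul] at h
    exact ⟨Sym.oneOrPos_of_factors _ _ _ fun p hp => h p (Multiset.mem_add.2 (.inl hp)),
      Sym.oneOrPos_of_factors _ _ _ fun p hp => h p (Multiset.mem_add.2 (.inr hp))⟩

/-- The symbols of positive type; they are stable under products. -/
def FPlus (α δ₀ : ℝ) : Submonoid Sym where
  carrier := {τ | τ.IsPlus α δ₀}
  one_mem' := (Sym.isPlus_iff _ _ _).2 (by
    intro p hp; exact absurd hp (Multiset.notMem_zero p))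
  mul_mem' := by
    intro a b ha hb
    refine (Sym.isPlus_iff _ _ _).2 fun p hp => ?_
    rw [Sym.factors_mul] at hp
    rcases Multiset.mem_add.1 hp with hp | hp
    · exact (Sym.isPlus_iff _ _ _).1 ha p hp
    · exact (Sym.isPlus_iff _ _ _).1 hb p hp

lemma X_mem_FPlus (α δ₀ : ℝ) (i : Fin 4) : Sym.X i ∈ FPlus α δ₀ := by
  refine (Sym.isPlus_iff _ _ _).2 fun p hp => ?_
  rw [show (Sym.X i).factors = {Sym.X i} from rfl, Multiset.mem_singleton] at hp
  subst hp
  change (0 : ℝ) < (scaling i : ℝ)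
  fin_cases i <;> simp [scaling]

/-! ### The coproduct -/

/-- Finite linear combinations of symbols. -/
abbrev H : Type := MonoidAlgebra ℝ Sym

/-- Finite linear combinations of symbols of positive type. -/
abbrev HPlus (α δ₀ : ℝ) : Type := MonoidAlgebra ℝ (FPlus α δ₀)

/-- A symbol as a basis vector. -/
def H.sym (τ : Sym) : H := MonoidAlgebra.single τ 1

/-- A symbol of positive type as a basis vector. -/
def HPlus.sym {α δ₀ : ℝ} (τ : FPlus α δ₀) : HPlus α δ₀ := MonoidAlgebra.single τ 1

/-- The linear extension of `I_k`. -/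
def intLin (k : MIdx) : H →ₗ[ℝ] H := MonoidAlgebra.mapDomainLinearMap ℝ ℝ (Sym.int k)

open Classical in
/-- The projection `P₊`: identity on symbols of positive type, zero on the other symbols. -/
def projPlus (α δ₀ : ℝ) : H →ₗ[ℝ] HPlus α δ₀ :=
  Finsupp.linearCombination ℝ
      (fun τ : Sym => if h : τ ∈ FPlus α δ₀ then HPlus.sym ⟨τ, h⟩ else 0) ∘ₗ
    (MonoidAlgebra.coeffLinearEquiv ℝ : H ≃ₗ[ℝ] (Sym →₀ ℝ)).toLinearMap

/-- `X_i` as an element of `HPlus`. -/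
def XPlus (α δ₀ : ℝ) (i : Fin 4) : HPlus α δ₀ := HPlus.sym ⟨Sym.X i, X_mem_FPlus α δ₀ i⟩

/-- `X^k` as an element of `HPlus`. -/
def XpowPlus (α δ₀ : ℝ) (k : MIdx) : HPlus α δ₀ := ∏ i, XPlus α δ₀ i ^ k i

/-- The term of index `(l, m)` in `Δ(I_k τ)`, namely
`(X^l / l!) ⊗ ((X^m / m!) P₊ I_{k+l+m} τ)`. -/
def intTerm (α δ₀ : ℝ) (k : MIdx) (τ : Sym) (p : MIdx × MIdx) : H ⊗[ℝ] HPlus α δ₀ :=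
  ((mfact p.1)⁻¹ • H.sym (Sym.Xpow p.1)) ⊗ₜ[ℝ]
    (((mfact p.2)⁻¹ • XpowPlus α δ₀ p.2) *
      projPlus α δ₀ (H.sym (Sym.int (k + p.1 + p.2) τ)))

lemma projPlus_sym_of_deg_nonpos (α δ₀ : ℝ) (k : MIdx) (τ : Sym)
    (h : Sym.deg α δ₀ (Sym.int k τ) ≤ 0) : projPlus α δ₀ (H.sym (Sym.int k τ)) = 0 := by
  have hn : Sym.int k τ ∉ FPlus α δ₀ := fun hp => by
    have := (Sym.isPlus_iff _ _ _).1 hp (Sym.int k τ) (by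
      rcases τ with ⟨a⟩; exact Multiset.mem_singleton_self _)
    linarith
  simp [projPlus, H.sym, hn]

/-- Only finitely many of the terms of `Δ(I_k τ)` are nonzero. -/
lemma finite_support_intTerm (α δ₀ : ℝ) (k : MIdx) (τ : Sym) :
    (Function.support (intTerm α δ₀ k τ)).Finite := by
  obtain ⟨n, hn⟩ := exists_nat_gt (Sym.deg α δ₀ τ + 2)
  refine ((Set.finite_Iic (fun _ : Fin 4 => n)).prod
    (Set.finite_Iic (fun _ : Fin 4 => n))).subset ?_
  rintro ⟨l, m⟩ hlm
  by_contra hc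
  apply hlm
  have hw : n ≤ wt (k + l + m) := by
    have : ∃ i, n ≤ l i + m i := by
      by_contra! hh
      exact hc ⟨fun i => by have := hh i; simp only; omega,
        fun i => by have := hh i; simp only; omega⟩
    obtain ⟨i, hi⟩ := this
    have h1 : 1 ≤ scaling i := by fin_cases i <;> simp [scaling]
    calc n ≤ 1 * (k + l + m) i := by simp only [Pi.add_apply]; omega
      _ ≤ scaling i * (k + l + m) i := Nat.mul_le_mul_right _ h1
      _ ≤ wt (k + l + m) := Finset.single_le_sum
          (f := fun i => scaling i * (k + l + m) i) (fun _ _ => Nat.zero_le _) (Finset.mem_univ i)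
  have hz : projPlus α δ₀ (H.sym (Sym.int (k + l + m) τ)) = 0 := by
    apply projPlus_sym_of_deg_nonpos
    have h2 : Sym.deg α δ₀ (Sym.int (k + l + m) τ)
        = Sym.deg α δ₀ τ + 2 - wt (k + l + m) := by rcases τ with ⟨a⟩; rfl
    have h3 : (n : ℝ) ≤ wt (k + l + m) := by exact_mod_cast hw
    linarith
  simp [intTerm, hz]

/-- The coproduct `Δ` on formal expressions. -/
def PreSym.coprod (α δ₀ : ℝ) : PreSym → H ⊗[ℝ] HPlus α δ₀
  | .one => 1
  | .noise => H.sym Sym.noise ⊗ₜ 1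
  | .X i => H.sym (Sym.X i) ⊗ₜ 1 + 1 ⊗ₜ XPlus α δ₀ i
  | .C j => H.sym (Sym.C j) ⊗ₜ 1
  | .mul a b => a.coprod α δ₀ * b.coprod α δ₀
  | .int k a => (intLin k).rTensor (HPlus α δ₀) (a.coprod α δ₀)
      + ∑ᶠ p : MIdx × MIdx, intTerm α δ₀ k (Sym.mk a) p

/-- The coproduct `Δ` on symbols. -/
def Sym.coprod (α δ₀ : ℝ) : Sym →* H ⊗[ℝ] HPlus α δ₀ where
  toFun := Quot.lift (PreSym.coprod α δ₀) (by
    intro a b h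
    induction h with
    | comm a b => simp only [PreSym.coprod, mul_comm]
    | assoc a b c => simp only [PreSym.coprod, mul_assoc]
    | one_mul a => simp only [PreSym.coprod, one_mul]
    | mul_left b _ ih => simp only [PreSym.coprod, ih]
    | mul_right a _ ih => simp only [PreSym.coprod, ih]
    | int k h ih =>
      simp only [PreSym.coprod, ih]
      rw [show Sym.mk _ = Sym.mk _ from Quot.sound h])
  map_one' := rfl
  map_mul' := by rintro ⟨a⟩ ⟨b⟩; rfl

/-- The coproduct `Δ : H → H ⊗ HPlus`, extended linearly (and multiplicative). -/
def coprod (α δ₀ : ℝ) : H →ₐ[ℝ] H ⊗[ℝ] HPlus α δ₀ :=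
  MonoidAlgebra.lift ℝ (H ⊗[ℝ] HPlus α δ₀) Sym (Sym.coprod α δ₀)

lemma coprod_sym (α δ₀ : ℝ) (τ : Sym) : coprod α δ₀ (H.sym τ) = Sym.coprod α δ₀ τ := by
  simp [coprod, H.sym]

/-- The recursive rule for `Δ(I_k τ)`. -/
lemma coprod_int (α δ₀ : ℝ) (k : MIdx) (τ : Sym) :
    coprod α δ₀ (H.sym (Sym.int k τ)) =
      (intLin k).rTensor (HPlus α δ₀) (coprod α δ₀ (H.sym τ))
        + ∑ᶠ p : MIdx × MIdx, intTerm α δ₀ k τ p := by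
  rw [coprod_sym, coprod_sym]; rcases τ with ⟨a⟩; rfl

/-- `Γ_g = (id ⊗ g) Δ`, for a group-like (that is, multiplicative and unital) functional `g`
on `HPlus`. -/
def Gam (α δ₀ : ℝ) (g : HPlus α δ₀ →ₐ[ℝ] ℝ) : H →ₗ[ℝ] H :=
  (TensorProduct.rid ℝ H).toLinearMap ∘ₗ g.toLinearMap.lTensor H ∘ₗ (coprod α δ₀).toLinearMap

/-! ### The symbols needed for the equation -/

/-- `𝔐_F(U, Ξ)`, for `𝔐_F = {Ξ, Uⁿ : n ≤ 3}`: the symbol `Ξ` and all products of at most three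
elements of `U`. -/
def monomials (U : Set Sym) : Set Sym :=
  {Sym.noise} ∪ {τ | ∃ n ≤ 3, ∃ u : Fin n → Sym, (∀ i, u i ∈ U) ∧ τ = ∏ i, u i}

/-- The pair of sets `(W_n, U_n)`. -/
def WU : ℕ → Set Sym × Set Sym
  | 0 => (∅, ∅)
  | n + 1 =>
    let W : Set Sym := (WU n).1 ∪ monomials (WU n).2
    (W, Set.range Sym.Xpow ∪ Set.range Sym.C ∪ Sym.int 0 '' W)

/-- The set `F_F = ⋃ₙ (W_n ∪ U_n)`. -/
def FF : Set Sym := ⋃ n, (WU n).1 ∪ (WU n).2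

/-- The span `H_F` of `F_F`. -/
def HF : Submodule ℝ H := Submodule.span ℝ (H.sym '' FF)

/-- The set of homogeneities of the elements of `F_F`. -/
def AF (α δ₀ : ℝ) : Set ℝ := Sym.deg α δ₀ '' FF

/-- The subspace `T_γ` of `H_F` spanned by the elements of `F_F` of homogeneity `γ`. -/
def TF (α δ₀ : ℝ) (γ : AF α δ₀) : Submodule ℝ HF :=
  (Submodule.span ℝ (H.sym '' {τ | τ ∈ FF ∧ Sym.deg α δ₀ τ = γ})).comap HF.subtype

/-- The `ℓ¹` norm of the coefficients with respect to the basis of symbols. -/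
def l1Norm : Seminorm ℝ H :=
  Seminorm.of (fun v => v.coeff.sum fun _ c => |c|)
    (by
      intro v w
      classical
      have key : ∀ (u : H) (s : Finset Sym), u.coeff.support ⊆ s →
          (u.coeff.sum fun _ c => |c|) = ∑ τ ∈ s, |u.coeff τ| := fun u s hs =>
        Finsupp.sum_of_support_subset _ hs _ (by simp)
      rw [key v (v.coeff.support ∪ w.coeff.support) Finset.subset_union_left,
        key w (v.coeff.support ∪ w.coeff.support) Finset.subset_union_right,
        key (v + w) (v.coeff.support ∪ w.coeff.support) Finsupp.support_add,
        ← Finset.sum_add_distrib]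
      exact Finset.sum_le_sum fun τ _ => abs_add_le _ _)
    (by
      intro a v
      rcases eq_or_ne a 0 with rfl | ha
      · simp
      · have hs : (a • v).coeff.support = v.coeff.support := Finsupp.support_smul_eq ha
        change ∑ τ ∈ (a • v).coeff.support, |(a • v).coeff τ|
          = ‖a‖ * ∑ τ ∈ v.coeff.support, |v.coeff τ|
        rw [hs, Finset.mul_sum]
        exact Finset.sum_congr rfl fun τ _ => abs_mul _ _)

/-- The `ℓ¹` norm on `T_γ`. -/
def normF (α δ₀ : ℝ) (γ : AF α δ₀) : Seminorm ℝ (TF α δ₀ γ) :=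
  l1Norm.comp (HF.subtype ∘ₗ (TF α δ₀ γ).subtype)

lemma one_mem_FF : (1 : Sym) ∈ FF :=
  Set.mem_iUnion.2 ⟨1, Or.inr (Or.inl (Or.inl ⟨0, by simp [Sym.Xpow]⟩))⟩

/-- The unit `1` as an element of `H_F`. -/
def oneF : HF := ⟨H.sym 1, Submodule.subset_span ⟨1, one_mem_FF, rfl⟩⟩

/-- The structure group `G_F`: all operators on `H_F` given by some `Γ_g`. -/
def GF (α δ₀ : ℝ) : Set (Module.End ℝ HF) :=
  {Φ | ∃ g : HPlus α δ₀ →ₐ[ℝ] ℝ, ∀ v : HF, (Φ v : H) = Gam α δ₀ g v}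

end PhiFour

end

/-!
Two independent facts make `(A, H_F, G_F)` a regularity structure.

*Counting symbols.* Let `W` and `U` be the unions of the `W_n` and of the `U_n`; then `FF = W`
(`FF_eq_WW`). The least homogeneity in `W` is `α`, attained at `Ξ`, and the least one in `U` is
`α + 2`, attained at `I(Ξ)` (`deg_lower_bound`). Measured from these minima, a product of three
elements of `U` gains the positive amount `3(α + 2) - α = 2α + 6`, so an induction on the number of
such gains shows that only finitely many symbols have homogeneity below a given bound
(`finite_deg_lt`); hence the index set is bounded below and locally finite, and each `T_γ` is finite
dimensional. That `1` spans `T_0` (`eq_one_of_deg_eq_zero`) is a finite check: a product of three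
elements of `U` has homogeneity zero only if negative factors, which are `C_j` and `I(Ξ)`, are
compensated by positive ones. The positive elements of `U` of least homogeneity are `I(I(Ξ)³)`,
`I(I(Ξ)²C_j)` and `I(I(Ξ)²)`, and on the given range of parameters every possible compensation comes
down to `2δ₀ = 3α + 8`, which is excluded.

*The group property.* Each `Γ_g` is an algebra endomorphism of `H` which translates `X` by a vector
`x`, fixes `Ξ` and `C_j`, and satisfies
`Γ (I_k τ) = I_k (Γ τ) + ∑_l X^l / l! P_{k+l}(τ)`,
where `P_k(τ) = ∑_m x^m / m! g(P₊ I_{k+m} τ)` vanishes unless `|I_k τ| > 0`. Conversely, every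
endomorphism of this form is some `Γ_g` (`IsRecentering.exists_eq_gamHom`): a character of `HPlus`
can be prescribed freely on the `X_i` and on the `I_k τ` of positive homogeneity, and `P` determines
the values `g(P₊ I_k τ)` by shifting back by `-x`. So no coproduct on `HPlus` and no coassociativity
are needed. By Taylor's formula for finite sums (`taylor_add_left`) the composition of two such
maps has the same form (`IsRecentering.comp`). The inverse of `Γ_g` is constructed by recursion on
symbols,
`M (I_k τ) = I_k (M τ) - ∑_l X^l / l! g(P₊ I_{k+l} (M τ))`,
and it is again of this form (`isRecentering_invHom`, `gamHom_comp_invHom`).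

Triangularity follows from the recursive formula by structural induction
(`IsRecentering.sub_mem_of`), and so does the stability of `H_F` (`IsRecentering.map_mem`). The
completeness of `T_γ` and the boundedness of the operators hold because `T_γ` is finite dimensional.
-/

/-! ### Norms on finite-dimensional spaces -/

section FiniteDimensional

variable {E F : Type*} [AddCommGroup E] [Module ℝ E] [FiniteDimensional ℝ E] [AddCommGroup F]
  [Module ℝ F]

/-- On a finite-dimensional space, a norm dominates every seminorm. -/
lemma Seminorm.exists_le_mul_of_finiteDimensional (N : Seminorm ℝ E)
    (hN : ∀ x, N x = 0 → x = 0) (M : Seminorm ℝ F) (f : E →ₗ[ℝ] F) :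
    ∃ K : ℝ, ∀ x, M (f x) ≤ K * N x := by
  let _ : NormedAddCommGroup E := AddGroupNorm.toNormedAddCommGroup
    { N.toAddGroupSeminorm with eq_zero_of_map_eq_zero' := hN }
  let _ : NormedSpace ℝ E := ⟨fun a x => (map_smul_eq_mul N a x).le⟩
  let b := Module.finBasis ℝ E
  refine ⟨∑ i, ‖(b.coord i).toContinuousLinearMap‖ * M (f (b i)), fun x => ?_⟩
  calc M (f x) = M (∑ i, b.repr x i • f (b i)) := by
        conv_lhs => rw [← b.sum_repr x]
        simp only [map_sum, map_smul]
    _ ≤ ∑ i, M (b.repr x i • f (b i)) :=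
        Finset.le_sum_of_subadditive M (map_zero M).le (map_add_le_add M) _ _
    _ ≤ ∑ i, ‖(b.coord i).toContinuousLinearMap‖ * M (f (b i)) * N x := by
        refine Finset.sum_le_sum fun i _ => ?_
        rw [map_smul_eq_mul, mul_right_comm]
        exact mul_le_mul_of_nonneg_right ((b.coord i).toContinuousLinearMap.le_opNorm x)
          (apply_nonneg M _)
    _ = _ := (Finset.sum_mul _ _ _).symm

/-- A finite-dimensional normed space is complete. -/
lemma Seminorm.exists_lim_of_finiteDimensional (N : Seminorm ℝ E)
    (hN : ∀ x, N x = 0 → x = 0) (u : ℕ → E)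
    (hu : ∀ ε > 0, ∃ n₀, ∀ m ≥ n₀, ∀ n ≥ n₀, N (u m - u n) < ε) :
    ∃ x, ∀ ε > 0, ∃ n₀, ∀ n ≥ n₀, N (u n - x) < ε := by
  let _ : NormedAddCommGroup E := AddGroupNorm.toNormedAddCommGroup
    { N.toAddGroupSeminorm with eq_zero_of_map_eq_zero' := hN }
  let _ : NormedSpace ℝ E := ⟨fun a x => (map_smul_eq_mul N a x).le⟩
  have := FiniteDimensional.complete ℝ E
  have hd : ∀ x y : E, dist x y = N (x - y) := fun x y => dist_eq_norm x y
  obtain ⟨x, hx⟩ := cauchySeq_tendsto_of_complete (u := u) (Metric.cauchySeq_iff.2 fun ε hε => by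
    obtain ⟨n₀, h⟩ := hu ε hε
    exact ⟨n₀, fun m hm n hn => by rw [hd]; exact h m hm n hn⟩)
  refine ⟨x, fun ε hε => ?_⟩
  obtain ⟨n₀, h⟩ := Metric.tendsto_atTop.1 hx ε hε
  exact ⟨n₀, fun n hn => by rw [← hd]; exact h n hn⟩

end FiniteDimensional

noncomputable section

namespace PhiFour

/-! ### The symbols of the equation and their homogeneities -/

lemma Sym.deg_int (α δ₀ : ℝ) (k : MIdx) (τ : Sym) :
    Sym.deg α δ₀ (Sym.int k τ) = Sym.deg α δ₀ τ + 2 - wt k := by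
  rcases τ with ⟨a⟩; rfl

lemma Sym.deg_prod (α δ₀ : ℝ) {ι : Type*} (s : Finset ι) (f : ι → Sym) :
    Sym.deg α δ₀ (∏ i ∈ s, f i) = ∑ i ∈ s, Sym.deg α δ₀ (f i) := by
  classical
  induction s using Finset.induction_on with
  | empty => rfl
  | insert i s hi ih => rw [Finset.prod_insert hi, Finset.sum_insert hi, Sym.deg_mul, ih]

lemma Sym.deg_pow (α δ₀ : ℝ) (a : Sym) (n : ℕ) :
    Sym.deg α δ₀ (a ^ n) = n * Sym.deg α δ₀ a := by
  induction n with
  | zero => simpa using Sym.deg_one α δ₀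
  | succ n ih => rw [pow_succ, Sym.deg_mul, ih]; push_cast; ring

lemma Sym.deg_Xpow (α δ₀ : ℝ) (k : MIdx) : Sym.deg α δ₀ (Sym.Xpow k) = wt k := by
  simp only [Sym.Xpow, Sym.deg_prod, Sym.deg_pow, wt]
  push_cast
  refine Finset.sum_congr rfl fun i _ => ?_
  rw [mul_comm]; rfl

lemma wt_add (k l : MIdx) : wt (k + l) = wt k + wt l := by
  simp [wt, mul_add, Finset.sum_add_distrib]

lemma le_wt (k : MIdx) (i : Fin 4) : k i ≤ wt k := by
  have h1 : 1 ≤ scaling i := by fin_cases i <;> simp [scaling]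
  calc k i ≤ scaling i * k i := Nat.le_mul_of_pos_left _ h1
    _ ≤ wt k := Finset.single_le_sum (f := fun i => scaling i * k i)
      (fun _ _ => Nat.zero_le _) (Finset.mem_univ i)

lemma wt_eq_zero {k : MIdx} (h : wt k = 0) : k = 0 := by
  funext i
  have := le_wt k i
  simp only [Pi.zero_apply]
  omega

lemma wt_zero : wt 0 = 0 := by simp [wt]

lemma finite_wt_lt (R : ℝ) : {k : MIdx | (wt k : ℝ) < R}.Finite := by
  obtain ⟨n, hn⟩ := exists_nat_gt R
  refine (Set.finite_Iic (fun _ : Fin 4 => n)).subset fun k hk i => ?_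
  have h1 : (wt k : ℝ) < n := lt_trans hk hn
  have h2 : wt k < n := by exact_mod_cast h1
  exact (le_wt k i).trans h2.le

lemma Xpow_zero : Sym.Xpow 0 = 1 := by simp [Sym.Xpow]

/-- The union `W` of the sets `W_n`. -/
def WW : Set Sym := ⋃ n, (WU n).1

/-- The union `U` of the sets `U_n`. -/
def UU : Set Sym := ⋃ n, (WU n).2

lemma WU_mono (n : ℕ) : (WU n).1 ⊆ (WU (n + 1)).1 ∧ (WU n).2 ⊆ (WU (n + 1)).2 := by
  refine ⟨Set.subset_union_left, ?_⟩
  cases n with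
  | zero => exact Set.empty_subset _
  | succ n => exact Set.union_subset_union_right _ (Set.image_mono Set.subset_union_left)

lemma WU_snd_mono : Monotone fun n => (WU n).2 := monotone_nat_of_le_succ fun n => (WU_mono n).2

lemma Xpow_mem_UU (k : MIdx) : Sym.Xpow k ∈ UU :=
  Set.mem_iUnion.2 ⟨1, Or.inl (Or.inl ⟨k, rfl⟩)⟩

lemma one_mem_UU : (1 : Sym) ∈ UU := Xpow_zero ▸ Xpow_mem_UU 0

lemma C_mem_UU (j : Fin 2) : Sym.C j ∈ UU :=
  Set.mem_iUnion.2 ⟨1, Or.inl (Or.inr ⟨j, rfl⟩)⟩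

lemma int_mem_UU {w : Sym} (h : w ∈ WW) : Sym.int 0 w ∈ UU := by
  obtain ⟨n, hn⟩ := Set.mem_iUnion.1 h
  exact Set.mem_iUnion.2 ⟨n + 1, Or.inr ⟨w, Or.inl hn, rfl⟩⟩

lemma noise_mem_WW : Sym.noise ∈ WW := Set.mem_iUnion.2 ⟨1, Or.inr (Or.inl rfl)⟩

lemma mul_mem_WW {u v w : Sym} (hu : u ∈ UU) (hv : v ∈ UU) (hw : w ∈ UU) : u * v * w ∈ WW := by
  obtain ⟨l, hl⟩ := Set.mem_iUnion.1 hu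
  obtain ⟨m, hm⟩ := Set.mem_iUnion.1 hv
  obtain ⟨n, hn⟩ := Set.mem_iUnion.1 hw
  refine Set.mem_iUnion.2 ⟨l + m + n + 1, Or.inr (Or.inr ⟨3, le_rfl, ![u, v, w], ?_, ?_⟩)⟩
  · intro i
    fin_cases i
    · exact WU_snd_mono (by omega : l ≤ l + m + n) hl
    · exact WU_snd_mono (by omega : m ≤ l + m + n) hm
    · exact WU_snd_mono (by omega : n ≤ l + m + n) hn
  · simp [Fin.prod_univ_three]

lemma UU_subset_WW : UU ⊆ WW := fun u hu => by
  simpa using mul_mem_WW hu one_mem_UU one_mem_UU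

lemma mem_UU {u : Sym} (h : u ∈ UU) :
    (∃ k, u = Sym.Xpow k) ∨ (∃ j, u = Sym.C j) ∨ ∃ w ∈ WW, u = Sym.int 0 w := by
  obtain ⟨n, hn⟩ := Set.mem_iUnion.1 h
  cases n with
  | zero => exact hn.elim
  | succ n =>
    rcases hn with (⟨k, rfl⟩ | ⟨j, rfl⟩) | ⟨w, hw, rfl⟩
    · exact Or.inl ⟨k, rfl⟩
    · exact Or.inr (Or.inl ⟨j, rfl⟩)
    · exact Or.inr (Or.inr ⟨w, Set.mem_iUnion.2 ⟨n + 1, hw⟩, rfl⟩)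

/-- Products of fewer than three elements are padded with the factor `1`. -/
lemma exists_mul_of_prod {q : Sym → Prop} (h1 : q 1) {n : ℕ} (hn : n ≤ 3) (u : Fin n → Sym)
    (hu : ∀ i, q (u i)) : ∃ a b c, q a ∧ q b ∧ q c ∧ ∏ i, u i = a * b * c := by
  interval_cases n
  · exact ⟨1, 1, 1, h1, h1, h1, by simp⟩
  · exact ⟨u 0, 1, 1, hu 0, h1, h1, by simp⟩
  · exact ⟨u 0, u 1, 1, hu 0, hu 1, h1, by simp [Fin.prod_univ_two]⟩
  · exact ⟨u 0, u 1, u 2, hu 0, hu 1, hu 2, by simp [Fin.prod_univ_three]⟩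

lemma mem_WW {w : Sym} (h : w ∈ WW) :
    w = Sym.noise ∨ ∃ a ∈ UU, ∃ b ∈ UU, ∃ c ∈ UU, w = a * b * c := by
  obtain ⟨n, hn⟩ := Set.mem_iUnion.1 h
  induction n with
  | zero => exact hn.elim
  | succ n ih =>
    rcases hn with hn | rfl | ⟨m, hm, u, hu, rfl⟩
    · exact ih hn
    · exact Or.inl rfl
    · obtain ⟨a, b, c, ha, hb, hc, h⟩ := exists_mul_of_prod (q := (· ∈ UU)) one_mem_UU hm u
        fun i => Set.mem_iUnion.2 ⟨n, hu i⟩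
      exact Or.inr ⟨a, ha, b, hb, c, hc, h⟩

lemma FF_eq_WW : FF = WW := by
  rw [FF, Set.iUnion_union_distrib]
  exact Set.union_eq_left.2 UU_subset_WW

/-- Structural induction for the symbols of the equation. -/
lemma WW_induction {p q : Sym → Prop} (noise : p Sym.noise)
    (mul : ∀ a ∈ UU, ∀ b ∈ UU, ∀ c ∈ UU, q a → q b → q c → p (a * b * c))
    (Xpow : ∀ k, q (Sym.Xpow k)) (C : ∀ j, q (Sym.C j))
    (int : ∀ w ∈ WW, p w → q (Sym.int 0 w)) :
    (∀ w ∈ WW, p w) ∧ ∀ u ∈ UU, q u := by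
  have key : ∀ n, (∀ w ∈ (WU n).1, p w) ∧ ∀ u ∈ (WU n).2, q u := by
    intro n
    induction n with
    | zero => exact ⟨fun w hw => hw.elim, fun u hu => hu.elim⟩
    | succ n ih =>
      have hW : ∀ w ∈ (WU (n + 1)).1, p w := by
        rintro w (hw | rfl | ⟨m, hm, u, hu, rfl⟩)
        · exact ih.1 w hw
        · exact noise
        · obtain ⟨a, b, c, ha, hb, hc, h⟩ := exists_mul_of_prod (q := fun s => s ∈ UU ∧ q s)
            ⟨one_mem_UU, Xpow_zero ▸ Xpow 0⟩ hm u
            fun i => ⟨Set.mem_iUnion.2 ⟨n, hu i⟩, ih.2 _ (hu i)⟩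
          rw [h]
          exact mul a ha.1 b hb.1 c hc.1 ha.2 hb.2 hc.2
      refine ⟨hW, ?_⟩
      rintro u ((⟨k, rfl⟩ | ⟨j, rfl⟩) | ⟨w, hw, rfl⟩)
      · exact Xpow k
      · exact C j
      · exact int w (Set.mem_iUnion.2 ⟨n + 1, hw⟩) (hW w hw)
  exact ⟨fun w hw => by obtain ⟨n, hn⟩ := Set.mem_iUnion.1 hw; exact (key n).1 w hn,
    fun u hu => by obtain ⟨n, hn⟩ := Set.mem_iUnion.1 hu; exact (key n).2 u hn⟩

/-- `Ξ` has the least homogeneity in `W`, and `I(Ξ)` the least one in `U`. -/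
lemma deg_lower_bound {α δ₀ : ℝ} (hα : -18 / 7 < α) (hα' : α < -5 / 2)
    (hδ : 4 * α + 10 < -δ₀) :
    (∀ w ∈ WW, α ≤ Sym.deg α δ₀ w) ∧ ∀ u ∈ UU, α + 2 ≤ Sym.deg α δ₀ u := by
  refine WW_induction (le_refl α) ?_ ?_ ?_ ?_
  · intro a _ b _ c _ ha hb hc
    rw [Sym.deg_mul, Sym.deg_mul]
    linarith
  · intro k
    rw [Sym.deg_Xpow]
    have : (0 : ℝ) ≤ wt k := Nat.cast_nonneg _
    linarith
  · intro j
    change α + 2 ≤ -δ₀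
    linarith
  · intro w _ hw
    rw [Sym.deg_int, wt_zero]
    push_cast
    linarith

/-- Subcriticality: a product of three elements of `U` raises the homogeneity, measured from its
minimum, by the positive amount `2α + 6`; hence only finitely many symbols have homogeneity below
a given bound. -/
lemma finite_deg_lt {α δ₀ : ℝ} (hα : -18 / 7 < α) (hα' : α < -5 / 2)
    (hδ : 4 * α + 10 < -δ₀) (R : ℝ) : {w | w ∈ WW ∧ Sym.deg α δ₀ w < R}.Finite := by
  obtain ⟨lowW, lowU⟩ := deg_lower_bound (δ₀ := δ₀) hα hα' hδ
  have key : ∀ n : ℕ, {w | w ∈ WW ∧ Sym.deg α δ₀ w < α + n * (2 * α + 6)}.Finite := by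
    intro n
    induction n with
    | zero =>
      convert Set.finite_empty
      ext w
      simp only [Set.mem_ofPred_eq, Set.mem_empty_iff_false, iff_false, not_and, not_lt]
      intro hw
      simpa using lowW w hw
    | succ n ih =>
      have hU : {u | u ∈ UU ∧ Sym.deg α δ₀ u < α + 2 + n * (2 * α + 6)}.Finite := by
        refine (((finite_wt_lt (α + 2 + n * (2 * α + 6))).image Sym.Xpow).union
          ((Set.finite_range Sym.C).union (ih.image (Sym.int 0)))).subset ?_
        rintro u ⟨hu, hd⟩
        rcases mem_UU hu with ⟨k, rfl⟩ | ⟨j, rfl⟩ | ⟨w, hw, rfl⟩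
        · rw [Sym.deg_Xpow] at hd
          exact Or.inl ⟨k, hd, rfl⟩
        · exact Or.inr (Or.inl ⟨j, rfl⟩)
        · rw [Sym.deg_int, wt_zero] at hd
          push_cast at hd
          exact Or.inr (Or.inr ⟨w, ⟨hw, by linarith⟩, rfl⟩)
      refine ((Set.finite_singleton Sym.noise).union
        (((hU.prod (hU.prod hU)).image fun p => p.1 * p.2.1 * p.2.2))).subset ?_
      rintro w ⟨hw, hd⟩
      rcases mem_WW hw with rfl | ⟨a, ha, b, hb, c, hc, rfl⟩
      · exact Or.inl rfl
      · have h1 := lowU a ha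
        have h2 := lowU b hb
        have h3 := lowU c hc
        rw [Sym.deg_mul, Sym.deg_mul] at hd
        push_cast at hd
        exact Or.inr ⟨(a, b, c), ⟨⟨ha, by linarith⟩, ⟨hb, by linarith⟩, hc, by linarith⟩, rfl⟩
  obtain ⟨n, hn⟩ := exists_nat_gt ((R - α) / (2 * α + 6))
  rw [div_lt_iff₀ (by linarith)] at hn
  exact (key n).subset fun w hw => ⟨hw.1, by linarith [hw.2]⟩

/-- The possible homogeneities of elements of `U`: those of `1`, of `C_j` and of `I(Ξ)`, and the
others, which are at least that of `I(I(Ξ)³)`. -/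
lemma deg_UU_cases {α δ₀ : ℝ} (hα : -18 / 7 < α) (hα' : α < -5 / 2)
    (hδ : 4 * α + 10 < -δ₀) {u : Sym} (hu : u ∈ UU) :
    u = 1 ∨ Sym.deg α δ₀ u = -δ₀ ∨ Sym.deg α δ₀ u = α + 2 ∨ 3 * α + 8 ≤ Sym.deg α δ₀ u := by
  obtain ⟨-, lowU⟩ := deg_lower_bound (δ₀ := δ₀) hα hα' hδ
  rcases mem_UU hu with ⟨k, rfl⟩ | ⟨j, rfl⟩ | ⟨w, hw, rfl⟩
  · rcases Nat.eq_zero_or_pos (wt k) with h | h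
    · rw [wt_eq_zero h]
      exact Or.inl Xpow_zero
    · rw [Sym.deg_Xpow]
      have : (1 : ℝ) ≤ wt k := by exact_mod_cast h
      exact Or.inr (Or.inr (Or.inr (by linarith)))
  · exact Or.inr (Or.inl rfl)
  · rw [Sym.deg_int, wt_zero]
    push_cast
    rcases mem_WW hw with rfl | ⟨a, ha, b, hb, c, hc, rfl⟩
    · exact Or.inr (Or.inr (Or.inl (by change α + 2 - 0 = _; ring)))
    · have h1 := lowU a ha
      have h2 := lowU b hb
      have h3 := lowU c hc
      rw [Sym.deg_mul, Sym.deg_mul]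
      exact Or.inr (Or.inr (Or.inr (by linarith)))

/-- A finer list of the homogeneities of elements of `U`, whose last case starts at
`I(I(Ξ)²)`. The value `-2(α + 2)`, which would cancel `I(Ξ)²`, is not attained because
`2δ₀ ≠ 3α + 8`. -/
lemma deg_UU_cases' {α δ₀ : ℝ} (hα : -18 / 7 < α) (hα' : α < -5 / 2)
    (hδ : 4 * α + 10 < -δ₀) (hne : 2 * δ₀ ≠ 3 * α + 8) {u : Sym} (hu : u ∈ UU) :
    u = 1 ∨ Sym.deg α δ₀ u = -δ₀ ∨ Sym.deg α δ₀ u = α + 2 ∨ Sym.deg α δ₀ u = 3 * α + 8 ∨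
      Sym.deg α δ₀ u = 2 * α + 6 - δ₀ ∨
      (2 * α + 6 ≤ Sym.deg α δ₀ u ∧ Sym.deg α δ₀ u ≠ -2 * (α + 2)) := by
  rcases mem_UU hu with ⟨k, rfl⟩ | ⟨j, rfl⟩ | ⟨w, hw, rfl⟩
  · rcases Nat.lt_trichotomy (wt k) 1 with h | h | h
    · rw [wt_eq_zero (by omega : wt k = 0)]
      exact Or.inl Xpow_zero
    · rw [Sym.deg_Xpow, h]
      push_cast
      exact Or.inr (Or.inr (Or.inr (Or.inr (Or.inr ⟨by linarith, fun h => by linarith⟩))))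
    · rw [Sym.deg_Xpow]
      have : (2 : ℝ) ≤ wt k := by exact_mod_cast h
      exact Or.inr (Or.inr (Or.inr (Or.inr (Or.inr ⟨by linarith, fun h => by linarith⟩))))
  · exact Or.inr (Or.inl rfl)
  · right; right
    rw [Sym.deg_int, wt_zero]
    push_cast
    rcases mem_WW hw with rfl | ⟨a, ha, b, hb, c, hc, rfl⟩
    · exact Or.inl (by change α + 2 - 0 = _; ring)
    · right
      have h0 := Sym.deg_one α δ₀
      have aux : ∀ v ∈ UU, Sym.deg α δ₀ v = 0 ∨ Sym.deg α δ₀ v = -δ₀ ∨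
          Sym.deg α δ₀ v = α + 2 ∨ 3 * α + 8 ≤ Sym.deg α δ₀ v := fun v hv =>
        (deg_UU_cases hα hα' hδ hv).imp_left fun h => by rw [h, h0]
      rw [Sym.deg_mul, Sym.deg_mul]
      have ha := aux a ha
      have hb := aux b hb
      have hc := aux c hc
      generalize Sym.deg α δ₀ a = x at *
      generalize Sym.deg α δ₀ b = y at *
      generalize Sym.deg α δ₀ c = z at *
      rcases ha with ha | ha | ha | ha <;> rcases hb with hb | hb | hb | hb <;>
        rcases hc with hc | hc | hc | hc <;>
        first
        | exact Or.inl (by linarith)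
        | exact Or.inr (Or.inl (by linarith))
        | exact Or.inr (Or.inr ⟨by linarith, fun h => by
            first
            | linarith
            | exact hne (by linarith)⟩)

/-- The unit is the only symbol of the equation with homogeneity zero. -/
lemma eq_one_of_deg_eq_zero {α δ₀ : ℝ} (hα : -18 / 7 < α) (hα' : α < -5 / 2)
    (hδ : 4 * α + 10 < -δ₀) (hδ' : -δ₀ < 0) (hne : 2 * δ₀ ≠ 3 * α + 8) {w : Sym} (hw : w ∈ WW)
    (h0 : Sym.deg α δ₀ w = 0) : w = 1 := by
  rcases mem_WW hw with rfl | ⟨a, ha, b, hb, c, hc, rfl⟩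
  · exact absurd (show α = 0 from h0) (by linarith)
  · -- No three homogeneities of elements of `U`, the first one not that of `1`, add up to zero.
    have key : ∀ x y z : ℝ, x + y + z = 0 →
        (x = -δ₀ ∨ x = α + 2 ∨ x = 3 * α + 8 ∨ x = 2 * α + 6 - δ₀ ∨
          (2 * α + 6 ≤ x ∧ x ≠ -2 * (α + 2))) →
        (y = 0 ∨ y = -δ₀ ∨ y = α + 2 ∨ y = 3 * α + 8 ∨ y = 2 * α + 6 - δ₀ ∨
          (2 * α + 6 ≤ y ∧ y ≠ -2 * (α + 2))) →
        (z = 0 ∨ z = -δ₀ ∨ z = α + 2 ∨ z = 3 * α + 8 ∨ z = 2 * α + 6 - δ₀ ∨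
          (2 * α + 6 ≤ z ∧ z ≠ -2 * (α + 2))) → False := by
      intro x y z h hx hy hz
      rcases hx with hx | hx | hx | hx | ⟨hx, hx'⟩ <;>
        rcases hy with hy | hy | hy | hy | hy | ⟨hy, hy'⟩ <;>
        rcases hz with hz | hz | hz | hz | hz | ⟨hz, hz'⟩ <;>
        first
        | linarith
        | exact hne (by linarith)
        | exact hx' (by linarith)
        | exact hy' (by linarith)
        | exact hz' (by linarith)
    rw [Sym.deg_mul, Sym.deg_mul] at h0
    have h1 := Sym.deg_one α δ₀
    have aux := fun v (hv : v ∈ UU) => deg_UU_cases' hα hα' hδ hne hv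
    have aux0 : ∀ v ∈ UU, Sym.deg α δ₀ v = 0 ∨ Sym.deg α δ₀ v = -δ₀ ∨ Sym.deg α δ₀ v = α + 2 ∨
        Sym.deg α δ₀ v = 3 * α + 8 ∨ Sym.deg α δ₀ v = 2 * α + 6 - δ₀ ∨
        (2 * α + 6 ≤ Sym.deg α δ₀ v ∧ Sym.deg α δ₀ v ≠ -2 * (α + 2)) := fun v hv =>
      (aux v hv).imp_left fun h => by rw [h, h1]
    rcases aux a ha with rfl | ha'
    · rcases aux b hb with rfl | hb'
      · rcases aux c hc with rfl | hc'
        · simp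
        · exact (key _ _ _ (by linarith) hc' (aux0 _ ha) (aux0 _ hb)).elim
      · exact (key _ _ _ (by linarith) hb' (aux0 _ ha) (aux0 _ hc)).elim
    · exact (key _ _ _ h0 ha' (aux0 _ hb) (aux0 _ hc)).elim

/-! ### Taylor sums -/

section Taylor

variable {A B : Type*} [CommRing A] [Algebra ℝ A] [CommRing B] [Algebra ℝ B]

/-- The divided power `x^l / l!`. -/
def dpow (x : Fin 4 → A) (l : MIdx) : A := (mfact l)⁻¹ • ∏ i, x i ^ l i

/-- The Taylor polynomial `∑ c_l x^l / l!`; it is meaningful for finitely supported `c` only. -/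
def taylor (x : Fin 4 → A) (c : MIdx → ℝ) : A := ∑ᶠ l, c l • dpow x l

lemma dpow_eq_prod (x : Fin 4 → A) (l : MIdx) :
    dpow x l = ∏ i, (((l i).factorial : ℝ)⁻¹ • x i ^ l i) := by
  rw [dpow, mfact, Finset.prod_smul, Finset.prod_inv_distrib]

lemma inv_factorial_smul_add_pow (x y : A) (n : ℕ) :
    ((n.factorial : ℝ)⁻¹ • (x + y) ^ n) = ∑ j ∈ Finset.Iic n,
      ((j.factorial : ℝ)⁻¹ • x ^ j) * (((n - j).factorial : ℝ)⁻¹ • y ^ (n - j)) := by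
  have hI : Finset.Iic n = Finset.range (n + 1) := by ext; simp
  rw [add_pow, Finset.smul_sum, hI]
  refine Finset.sum_congr rfl fun j hj => ?_
  have hj' : j ≤ n := Nat.lt_succ_iff.1 (Finset.mem_range.1 hj)
  rw [smul_mul_smul_comm, mul_comm _ ((n.choose j : ℕ) : A), ← nsmul_eq_mul,
    ← Nat.cast_smul_eq_nsmul ℝ, smul_smul, Nat.cast_choose ℝ hj']
  congr 1
  field_simp

/-- The binomial theorem for divided powers. -/
lemma dpow_add (x y : Fin 4 → A) (N : MIdx) :
    dpow (x + y) N = ∑ l ∈ Finset.Iic N, dpow x l * dpow y (N - l) := by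
  have hI : Finset.Iic N = Fintype.piFinset fun i => Finset.Iic (N i) := by
    ext l; simp [Pi.le_def]
  simp only [dpow_eq_prod, Pi.add_apply, inv_factorial_smul_add_pow, Finset.prod_univ_sum, hI,
    Finset.prod_mul_distrib, Pi.sub_apply]

lemma dpow_zero_left (l : MIdx) : dpow (0 : Fin 4 → A) l = if l = 0 then 1 else 0 := by
  split_ifs with h
  · subst h; simp [dpow, mfact]
  · obtain ⟨i, hi⟩ := Function.ne_iff.1 h
    rw [dpow, Finset.prod_eq_zero (Finset.mem_univ i) (zero_pow hi), smul_zero]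

lemma map_dpow (f : A →ₐ[ℝ] B) (x : Fin 4 → A) (l : MIdx) :
    f (dpow x l) = dpow (fun i => f (x i)) l := by
  simp [dpow, map_prod]

lemma finite_support_smul_dpow (x : Fin 4 → A) {c : MIdx → ℝ} (hc : c.support.Finite) :
    (Function.support fun l => c l • dpow x l).Finite :=
  hc.subset fun l hl h => hl (by simp only [h, zero_smul])

lemma map_taylor (f : A →ₐ[ℝ] B) (x : Fin 4 → A) {c : MIdx → ℝ} (hc : c.support.Finite) :
    f (taylor x c) = taylor (fun i => f (x i)) c := by
  rw [taylor, map_finsum f (finite_support_smul_dpow x hc)]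
  simp only [map_smul, map_dpow, taylor]

lemma taylor_add_coeff (x : Fin 4 → A) {c d : MIdx → ℝ} (hc : c.support.Finite)
    (hd : d.support.Finite) : taylor x (fun l => c l + d l) = taylor x c + taylor x d := by
  simp only [taylor, add_smul]
  exact finsum_add_distrib (finite_support_smul_dpow x hc) (finite_support_smul_dpow x hd)

lemma taylor_smul_coeff (x : Fin 4 → A) (a : ℝ) {c : MIdx → ℝ} (hc : c.support.Finite) :
    taylor x (fun l => a * c l) = a • taylor x c := by
  simp only [taylor, mul_smul]
  exact (smul_finsum' a (finite_support_smul_dpow x hc)).symm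

lemma taylor_neg_coeff (x : Fin 4 → A) (c : MIdx → ℝ) :
    taylor x (fun l => -c l) = -taylor x c := by
  simp only [taylor, neg_smul, finsum_neg_distrib]

lemma taylor_zero_left (c : MIdx → ℝ) : taylor (0 : Fin 4 → ℝ) c = c 0 := by
  rw [taylor, finsum_eq_single _ 0 fun l hl => by simp [dpow_zero_left, hl]]
  simp [dpow_zero_left]

lemma taylor_zero_coeff (x : Fin 4 → A) : taylor x (fun _ => 0) = 0 := by
  simp [taylor]

/-- A finite set of multi-indices lies in a box. -/
lemma exists_subset_Iic {s : Set MIdx} (hs : s.Finite) : ∃ n : MIdx, ∀ l ∈ s, l ≤ n := by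
  obtain ⟨n, hn⟩ := hs.bddAbove
  exact ⟨n, fun l hl => hn hl⟩

/-- Taylor's formula: re-expansion of a polynomial around a translated base point. -/
lemma taylor_add_left (x : Fin 4 → A) (y : Fin 4 → ℝ) {c : MIdx → ℝ} (hc : c.support.Finite) :
    taylor (fun i => x i + algebraMap ℝ A (y i)) c =
      taylor x fun l => taylor y fun m => c (l + m) := by
  classical
  obtain ⟨n, hn⟩ := exists_subset_Iic hc
  have hz : ∀ l, ¬ l ≤ n → c l = 0 := fun l hl => by
    by_contra h; exact hl (hn l h)
  have hy : ∀ l, (taylor y fun m => c (l + m)) =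
      ∑ m ∈ Finset.Iic n with l + m ≤ n, c (l + m) * dpow y m := by
    intro l
    rw [taylor, finsum_eq_sum_of_support_subset (s := {m ∈ Finset.Iic n | l + m ≤ n})]
    · rfl
    · intro m hm
      have h1 : l + m ≤ n := by
        by_contra h
        exact hm (by simp only [hz _ h, zero_smul])
      simpa using ⟨le_trans le_add_self h1, h1⟩
  rw [taylor, finsum_eq_sum_of_support_subset (s := Finset.Iic n), taylor,
    finsum_eq_sum_of_support_subset (s := Finset.Iic n)]
  · have hd : ∀ N, dpow (fun i => x i + algebraMap ℝ A (y i)) N =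
        ∑ l ∈ Finset.Iic N, dpow y (N - l) • dpow x l := by
      intro N
      have := dpow_add x (fun i => algebraMap ℝ A (y i)) N
      rw [show (fun i => x i + algebraMap ℝ A (y i)) = x + fun i => algebraMap ℝ A (y i) from rfl,
        this]
      refine Finset.sum_congr rfl fun l _ => ?_
      rw [Algebra.smul_def, mul_comm]
      congr 1
      exact (map_dpow (Algebra.ofId ℝ A) y (N - l)).symm
    simp only [hd, hy, Finset.smul_sum, Finset.sum_smul, smul_smul]
    rw [Finset.sum_sigma', Finset.sum_sigma']
    -- Both sides run over the pairs `(l, m)` with `l + m = N ≤ n`.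
    refine Finset.sum_nbij' (fun p => ⟨p.2, p.1 - p.2⟩) (fun p => ⟨p.1 + p.2, p.1⟩) ?_ ?_ ?_ ?_ ?_
    · rintro ⟨N, l⟩ h
      simp only [Finset.mem_sigma, Finset.mem_Iic, Finset.mem_filter] at h ⊢
      rw [add_tsub_cancel_of_le h.2]
      exact ⟨h.2.trans h.1, tsub_le_self.trans h.1, h.1⟩
    · rintro ⟨l, m⟩ h
      simp only [Finset.mem_sigma, Finset.mem_Iic, Finset.mem_filter] at h ⊢
      exact ⟨h.2.2, le_self_add⟩
    · rintro ⟨N, l⟩ h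
      simp only [Finset.mem_sigma, Finset.mem_Iic] at h
      simp only [add_tsub_cancel_of_le h.2]
    · rintro ⟨l, m⟩ h
      simp only [add_tsub_cancel_left]
    · rintro ⟨N, l⟩ h
      simp only [Finset.mem_sigma, Finset.mem_Iic] at h
      simp only [add_tsub_cancel_of_le h.2]
  · intro l hl
    simp only [Finset.coe_Iic, Set.mem_Iic]
    by_contra h
    refine hl ?_
    have : ∀ m, c (l + m) = 0 := fun m => hz _ fun h' => h (le_self_add.trans h')
    simp only [this, taylor_zero_coeff, zero_smul]
  · intro l hl
    simp only [Finset.coe_Iic, Set.mem_Iic]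
    by_contra h
    exact hl (by simp only [hz _ h, zero_smul])

lemma taylor_mem {S : Submodule ℝ A} {x : Fin 4 → A} {c : MIdx → ℝ}
    (h : ∀ l, c l ≠ 0 → dpow x l ∈ S) : taylor x c ∈ S := by
  refine finsum_induction (· ∈ S) S.zero_mem (fun _ _ => S.add_mem) fun l => ?_
  by_cases hl : c l = 0
  · rw [hl, zero_smul]; exact S.zero_mem
  · exact S.smul_mem _ (h l hl)

end Taylor

/-! ### Spans of symbols -/

lemma H.sym_one : H.sym 1 = 1 := rfl

lemma H.sym_mul (a b : Sym) : H.sym (a * b) = H.sym a * H.sym b :=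
  (MonoidAlgebra.of ℝ Sym).map_mul a b

lemma H.sym_Xpow (k : MIdx) : H.sym (Sym.Xpow k) = ∏ i, H.sym (Sym.X i) ^ k i := by
  change MonoidAlgebra.of ℝ Sym _ = ∏ i, MonoidAlgebra.of ℝ Sym _ ^ k i
  simp only [Sym.Xpow, map_prod, map_pow]

lemma intLin_sym (k : MIdx) (τ : Sym) : intLin k (H.sym τ) = H.sym (Sym.int k τ) := by
  simp [intLin, H.sym]

/-- The polynomials `X_i` as vectors. -/
def Xvec (i : Fin 4) : H := H.sym (Sym.X i)

lemma dpow_Xvec (l : MIdx) : dpow Xvec l = (mfact l)⁻¹ • H.sym (Sym.Xpow l) := by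
  rw [H.sym_Xpow]; rfl

/-- The span of the symbols in `S`. -/
def spanSym (S : Set Sym) : Submodule ℝ H := Submodule.span ℝ (H.sym '' S)

lemma sym_mem_spanSym {S : Set Sym} {τ : Sym} (h : τ ∈ S) : H.sym τ ∈ spanSym S :=
  Submodule.subset_span ⟨τ, h, rfl⟩

lemma spanSym_le {S : Set Sym} {p : Submodule ℝ H} : spanSym S ≤ p ↔ ∀ τ ∈ S, H.sym τ ∈ p := by
  rw [spanSym, Submodule.span_le, Set.image_subset_iff]; rfl

lemma spanSym_mono {S T : Set Sym} (h : S ⊆ T) : spanSym S ≤ spanSym T :=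
  Submodule.span_mono (Set.image_mono h)

lemma sum_coeff_sym (v : H) : v = ∑ τ ∈ v.coeff.support, v.coeff τ • H.sym τ := by
  conv_lhs => rw [← MonoidAlgebra.sum_coeff_single v]
  refine Finset.sum_congr rfl fun τ _ => ?_
  simp [H.sym]

lemma mem_spanSym {S : Set Sym} {v : H} : v ∈ spanSym S ↔ ∀ τ, v.coeff τ ≠ 0 → τ ∈ S := by
  constructor
  · intro h τ hτ
    by_contra hS
    have h1 : spanSym S ≤ LinearMap.ker
        (Finsupp.lapply τ ∘ₗ
          (MonoidAlgebra.coeffLinearEquiv ℝ : H ≃ₗ[ℝ] (Sym →₀ ℝ)).toLinearMap) := by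
      refine spanSym_le.2 fun σ hσ => ?_
      have : σ ≠ τ := fun h => hS (h ▸ hσ)
      simp [H.sym, this]
    exact hτ (h1 h)
  · intro h
    rw [sum_coeff_sym v]
    exact Submodule.sum_mem _ fun τ hτ => Submodule.smul_mem _ _
      (sym_mem_spanSym (h τ (Finsupp.mem_support_iff.1 hτ)))

lemma mul_mem_spanSym {S T U : Set Sym} (h : ∀ a ∈ S, ∀ b ∈ T, a * b ∈ U) {v w : H}
    (hv : v ∈ spanSym S) (hw : w ∈ spanSym T) : v * w ∈ spanSym U := by
  have h1 := Submodule.mul_mem_mul hv hw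
  rw [spanSym, spanSym, Submodule.span_mul_span] at h1
  refine Submodule.span_mono ?_ h1
  rintro _ ⟨_, ⟨a, ha, rfl⟩, _, ⟨b, hb, rfl⟩, rfl⟩
  exact ⟨a * b, h a ha b hb, H.sym_mul a b⟩

lemma intLin_mem_spanSym {S T : Set Sym} {k : MIdx} (h : ∀ a ∈ S, Sym.int k a ∈ T) {v : H}
    (hv : v ∈ spanSym S) : intLin k v ∈ spanSym T := by
  have : spanSym S ≤ (spanSym T).comap (intLin k) := spanSym_le.2 fun τ hτ => by
    rw [Submodule.mem_comap, intLin_sym]; exact sym_mem_spanSym (h τ hτ)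
  exact this hv

lemma ext_sym {M : Type*} [AddCommMonoid M] [Module ℝ M] {f g : H →ₗ[ℝ] M}
    (h : ∀ τ, f (H.sym τ) = g (H.sym τ)) : f = g := by
  refine LinearMap.ext fun v => ?_
  rw [sum_coeff_sym v]
  simp [h]

lemma algHom_ext_sym {f g : H →ₐ[ℝ] H} (h : ∀ τ, f (H.sym τ) = g (H.sym τ)) : f = g :=
  AlgHom.toLinearMap_injective (ext_sym h)

/-! ### Recentering maps -/

/-- A family of functionals `P_k` such that `P_k τ` vanishes unless `|I_k τ| > 0`. -/
def Vanishes (α δ₀ : ℝ) (P : MIdx → H →ₗ[ℝ] ℝ) : Prop :=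
  ∀ k τ, Sym.deg α δ₀ τ + 2 ≤ wt k → P k (H.sym τ) = 0

variable {α δ₀ : ℝ}

lemma Vanishes.finite {P : MIdx → H →ₗ[ℝ] ℝ} (hP : Vanishes α δ₀ P) (v : H) :
    (Function.support fun k => P k v).Finite := by
  obtain ⟨R, hR⟩ := (v.coeff.support.image (Sym.deg α δ₀)).exists_le
  refine (finite_wt_lt (R + 2)).subset fun k hk => ?_
  by_contra h
  refine hk ?_
  simp only [Set.mem_ofPred_eq, not_lt] at h
  simp only
  rw [sum_coeff_sym v, map_sum]
  refine Finset.sum_eq_zero fun τ hτ => ?_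
  have := hR _ (Finset.mem_image_of_mem _ hτ)
  rw [map_smul, hP k τ (by linarith), smul_zero]

lemma Vanishes.finite_add {P : MIdx → H →ₗ[ℝ] ℝ} (hP : Vanishes α δ₀ P) (k : MIdx) (v : H) :
    (Function.support fun l => P (k + l) v).Finite :=
  (hP.finite v).preimage (add_right_injective k).injOn

/-- The functionals `v ↦ ∑_m x^m / m! P_{k+m} v`. -/
def shift (x : Fin 4 → ℝ) (P : MIdx → H →ₗ[ℝ] ℝ) (hP : Vanishes α δ₀ P) (k : MIdx) :
    H →ₗ[ℝ] ℝ where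
  toFun v := taylor x fun m => P (k + m) v
  map_add' v w := by
    simp only [map_add]
    exact taylor_add_coeff x (hP.finite_add k v) (hP.finite_add k w)
  map_smul' a v := by
    simp only [map_smul, smul_eq_mul, RingHom.id_apply]
    exact taylor_smul_coeff x a (hP.finite_add k v)

lemma shift_apply (x : Fin 4 → ℝ) (P : MIdx → H →ₗ[ℝ] ℝ) (hP : Vanishes α δ₀ P) (k : MIdx)
    (v : H) : shift x P hP k v = taylor x fun m => P (k + m) v := rfl

lemma vanishes_shift (x : Fin 4 → ℝ) (P : MIdx → H →ₗ[ℝ] ℝ) (hP : Vanishes α δ₀ P) :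
    Vanishes α δ₀ (shift x P hP) := by
  intro k τ h
  have : ∀ m, P (k + m) (H.sym τ) = 0 := fun m => hP _ _ (by
    rw [wt_add]
    push_cast
    have : (0 : ℝ) ≤ wt m := Nat.cast_nonneg _
    linarith)
  simp only [shift_apply, this, taylor_zero_coeff]

/-- Shifting by `-x` and then by `x` is the identity. -/
lemma taylor_shift_neg (x : Fin 4 → ℝ) (P : MIdx → H →ₗ[ℝ] ℝ) (hP : Vanishes α δ₀ P) (k : MIdx)
    (v : H) : (taylor x fun m => shift (-x) P hP (k + m) v) = P k v := by
  have h := taylor_add_left x (-x) (hP.finite_add k v)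
  have hx : (fun i => x i + algebraMap ℝ ℝ ((-x) i)) = 0 := by
    funext i; simp
  rw [hx, taylor_zero_left, add_zero] at h
  simp only [shift_apply, add_assoc]
  exact h.symm

/-- An algebra endomorphism of the form of `Γ_g`: it translates `X` by `x`, and acts on `I_k τ` by
`I_k τ ↦ I_k (Γ τ) + ∑_l X^l / l! P_{k+l}(τ)`. -/
structure IsRecentering (x : Fin 4 → ℝ) (P : MIdx → H →ₗ[ℝ] ℝ) (Γ : H →ₐ[ℝ] H) : Prop where
  noise : Γ (H.sym Sym.noise) = H.sym Sym.noise
  X : ∀ i, Γ (Xvec i) = Xvec i + algebraMap ℝ H (x i)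
  C : ∀ j, Γ (H.sym (Sym.C j)) = H.sym (Sym.C j)
  int : ∀ k τ, Γ (H.sym (Sym.int k τ)) =
    intLin k (Γ (H.sym τ)) + taylor Xvec fun l => P (k + l) (H.sym τ)

section Recentering

variable {x y : Fin 4 → ℝ} {P Q : MIdx → H →ₗ[ℝ] ℝ} {Γ Γ' : H →ₐ[ℝ] H}

/-- Structural induction on symbols. -/
lemma Sym.induction {p : Sym → Prop} (one : p 1) (noise : p Sym.noise) (X : ∀ i, p (Sym.X i))
    (C : ∀ j, p (Sym.C j)) (mul : ∀ a b, p a → p b → p (a * b))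
    (int : ∀ k a, p a → p (Sym.int k a)) (τ : Sym) : p τ := by
  rcases τ with ⟨a⟩
  change p (Sym.mk a)
  induction a with
  | one => exact one
  | noise => exact noise
  | X i => exact X i
  | C j => exact C j
  | mul a b iha ihb => exact mul _ _ iha ihb
  | int k a ih => exact int k _ ih

lemma IsRecentering.intLin (h : IsRecentering x P Γ) (hP : Vanishes α δ₀ P) (k : MIdx) (v : H) :
    Γ (intLin k v) = PhiFour.intLin k (Γ v) + taylor Xvec fun l => P (k + l) v := by
  induction v using MonoidAlgebra.induction_linear with
  | zero => simp [taylor_zero_coeff]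
  | add v w hv hw =>
    simp only [map_add, hv, hw]
    rw [taylor_add_coeff _ (hP.finite_add k v) (hP.finite_add k w)]
    abel
  | single τ r =>
    have hr : (MonoidAlgebra.single τ r : H) = r • H.sym τ := by simp [H.sym]
    simp only [hr, map_smul, smul_eq_mul]
    rw [taylor_smul_coeff _ _ (hP.finite_add k _), intLin_sym, h.int, smul_add]

/-- A recentering map is determined by its data. -/
lemma IsRecentering.unique (h : IsRecentering x P Γ) (h' : IsRecentering x Q Γ')
    (hPQ : ∀ k τ, P k (H.sym τ) = Q k (H.sym τ)) : Γ = Γ' := by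
  refine algHom_ext_sym fun τ => ?_
  induction τ using Sym.induction with
  | one => simp [H.sym_one]
  | noise => rw [h.noise, h'.noise]
  | X i => exact (h.X i).trans (h'.X i).symm
  | C j => rw [h.C, h'.C]
  | mul a b ha hb => rw [H.sym_mul, map_mul, map_mul, ha, hb]
  | int k a ha => rw [h.int, h'.int, ha]; simp only [hPQ]

lemma sym_add_mem {S : Set Sym} {τ : Sym} {v : H} (hv : v - H.sym τ ∈ spanSym S)
    (hτ : H.sym τ ∈ spanSym S) : v ∈ spanSym S := by
  simpa using add_mem hv hτ

/-- If `v - τ` has terms of homogeneity less than `|τ|` only, then `v` has terms of homogeneity at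
most `|τ|`. -/
lemma mem_spanSym_le {τ : Sym} {v : H}
    (h : v - H.sym τ ∈ spanSym {σ | Sym.deg α δ₀ σ < Sym.deg α δ₀ τ}) :
    v ∈ spanSym {σ | Sym.deg α δ₀ σ ≤ Sym.deg α δ₀ τ} :=
by
  refine sym_add_mem (τ := τ) (spanSym_mono (fun σ hσ => ?_) h) (sym_mem_spanSym ?_)
  · rw [Set.mem_ofPred_eq] at hσ ⊢
    exact hσ.le
  · rw [Set.mem_ofPred_eq]

/-- Recentering maps are lower triangular for the homogeneity. The hypothesis on `P` is only used
along the structure of the symbol, so that it may itself depend on triangularity. -/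
lemma IsRecentering.sub_mem_of (h : IsRecentering x P Γ)
    (hP : ∀ k τ, Γ (H.sym τ) ∈ spanSym {σ | Sym.deg α δ₀ σ ≤ Sym.deg α δ₀ τ} →
      Sym.deg α δ₀ τ + 2 ≤ wt k → P k (H.sym τ) = 0) (τ : Sym) :
    Γ (H.sym τ) - H.sym τ ∈ spanSym {σ | Sym.deg α δ₀ σ < Sym.deg α δ₀ τ} := by
  induction τ using Sym.induction with
  | one => rw [H.sym_one, map_one, sub_self]; exact zero_mem _
  | noise => rw [h.noise, sub_self]; exact zero_mem _
  | X i =>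
    have h1 : Γ (H.sym (Sym.X i)) = H.sym (Sym.X i) + algebraMap ℝ H (x i) := h.X i
    rw [h1, add_sub_cancel_left, Algebra.algebraMap_eq_smul_one, ← H.sym_one]
    refine Submodule.smul_mem _ _ (sym_mem_spanSym ?_)
    change (0 : ℝ) < (scaling i : ℝ)
    fin_cases i <;> simp [scaling]
  | C j => rw [h.C, sub_self]; exact zero_mem _
  | mul a b ha hb =>
    rw [H.sym_mul, map_mul, show Γ (H.sym a) * Γ (H.sym b) - H.sym a * H.sym b =
      (Γ (H.sym a) - H.sym a) * Γ (H.sym b) + H.sym a * (Γ (H.sym b) - H.sym b) by ring]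
    refine add_mem (mul_mem_spanSym ?_ ha (mem_spanSym_le hb))
      (mul_mem_spanSym ?_ (sym_mem_spanSym (Set.mem_singleton a)) hb)
    · intro σ hσ ρ hρ
      simp only [Set.mem_ofPred_eq, Sym.deg_mul] at *
      linarith
    · rintro σ rfl ρ hρ
      simp only [Set.mem_ofPred_eq, Sym.deg_mul] at *
      linarith
  | int k a ha =>
    rw [h.int, ← intLin_sym, add_sub_right_comm, ← map_sub]
    refine add_mem (intLin_mem_spanSym ?_ ha) (taylor_mem fun l hl => ?_)
    · intro σ hσ
      simp only [Set.mem_ofPred_eq, Sym.deg_int] at *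
      linarith
    · rw [dpow_Xvec]
      refine Submodule.smul_mem _ _ (sym_mem_spanSym ?_)
      by_contra hc
      refine hl (hP _ _ (mem_spanSym_le ha) ?_)
      simp only [Set.mem_ofPred_eq, Sym.deg_int, Sym.deg_Xpow, not_lt] at hc
      rw [wt_add]
      push_cast
      linarith

lemma IsRecentering.sub_mem (h : IsRecentering x P Γ) (hP : Vanishes α δ₀ P) (τ : Sym) :
    Γ (H.sym τ) - H.sym τ ∈ spanSym {σ | Sym.deg α δ₀ σ < Sym.deg α δ₀ τ} :=
  h.sub_mem_of (fun k τ _ => hP k τ) τ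

lemma Vanishes.apply_eq_zero (hP : Vanishes α δ₀ P) {k : MIdx} {τ : Sym} {v : H}
    (hv : v ∈ spanSym {σ | Sym.deg α δ₀ σ ≤ Sym.deg α δ₀ τ}) (hk : Sym.deg α δ₀ τ + 2 ≤ wt k) :
    P k v = 0 := by
  have : spanSym {σ | Sym.deg α δ₀ σ ≤ Sym.deg α δ₀ τ} ≤ LinearMap.ker (P k) :=
    spanSym_le.2 fun σ hσ => hP k σ (by simp only [Set.mem_ofPred_eq] at hσ; linarith)
  exact this hv

/-- The data of a composition. -/
lemma IsRecentering.comp (h : IsRecentering x P Γ) (hP : Vanishes α δ₀ P)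
    (h' : IsRecentering y Q Γ') (hQ : Vanishes α δ₀ Q) :
    IsRecentering (x + y) (fun k => P k ∘ₗ Γ'.toLinearMap + shift x Q hQ k) (Γ.comp Γ') where
  noise := by simp [h.noise, h'.noise]
  X i := by
    rw [AlgHom.comp_apply, h'.X, map_add, h.X, AlgHom.commutes, add_assoc, ← map_add]
    rfl
  C j := by simp [h.C, h'.C]
  int k τ := by
    rw [AlgHom.comp_apply, AlgHom.comp_apply, h'.int, map_add, h.intLin hP,
      map_taylor Γ Xvec (hQ.finite_add k _)]
    simp only [h.X]
    rw [taylor_add_left Xvec x (hQ.finite_add k _), add_assoc, ← taylor_add_coeff]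
    · simp only [shift_apply, LinearMap.add_apply, LinearMap.comp_apply, AlgHom.toLinearMap_apply,
        add_assoc]
    · exact hP.finite_add k _
    · simpa only [shift_apply, add_assoc] using (vanishes_shift x Q hQ).finite_add k (H.sym τ)

lemma IsRecentering.vanishes_comp (hP : Vanishes α δ₀ P)
    (h' : IsRecentering y Q Γ') (hQ : Vanishes α δ₀ Q) :
    Vanishes α δ₀ (fun k => P k ∘ₗ Γ'.toLinearMap + shift x Q hQ k) := by
  intro k τ hk
  have h1 := hP.apply_eq_zero (mem_spanSym_le (h'.sub_mem hQ τ)) hk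
  have h2 := vanishes_shift x Q hQ k τ hk
  simp [h1, h2]

end Recentering

/-! ### The operators `Γ_g` as recentering maps -/

/-- The evaluation `id ⊗ g`, an algebra homomorphism. -/
def evalRight (g : HPlus α δ₀ →ₐ[ℝ] ℝ) : H ⊗[ℝ] HPlus α δ₀ →ₐ[ℝ] H :=
  Algebra.TensorProduct.lift (AlgHom.id ℝ H) ((Algebra.ofId ℝ H).comp g)
    fun _ _ => Commute.all _ _

lemma evalRight_tmul (g : HPlus α δ₀ →ₐ[ℝ] ℝ) (v : H) (w : HPlus α δ₀) :
    evalRight g (v ⊗ₜ w) = g w • v := by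
  rw [evalRight, Algebra.TensorProduct.lift_tmul, Algebra.smul_def, mul_comm]
  rfl

/-- The operator `Γ_g` as an algebra homomorphism. -/
def gamHom (g : HPlus α δ₀ →ₐ[ℝ] ℝ) : H →ₐ[ℝ] H := (evalRight g).comp (coprod α δ₀)

lemma gamHom_apply (g : HPlus α δ₀ →ₐ[ℝ] ℝ) (v : H) : gamHom g v = Gam α δ₀ g v := by
  have : (evalRight g).toLinearMap =
      (TensorProduct.rid ℝ H).toLinearMap ∘ₗ g.toLinearMap.lTensor H := by
    refine TensorProduct.ext' fun v w => ?_
    simp [evalRight_tmul]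
  exact LinearMap.congr_fun this (coprod α δ₀ v)

lemma evalRight_rTensor (g : HPlus α δ₀ →ₐ[ℝ] ℝ) (k : MIdx) (t : H ⊗[ℝ] HPlus α δ₀) :
    evalRight g ((intLin k).rTensor (HPlus α δ₀) t) = intLin k (evalRight g t) := by
  have : (evalRight g).toLinearMap ∘ₗ (intLin k).rTensor (HPlus α δ₀) =
      intLin k ∘ₗ (evalRight g).toLinearMap := by
    refine TensorProduct.ext' fun v w => ?_
    simp [evalRight_tmul]
  exact LinearMap.congr_fun this t

/-- The functionals `v ↦ g (P₊ I_k v)`. -/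
def intCoeff (g : HPlus α δ₀ →ₐ[ℝ] ℝ) (k : MIdx) : H →ₗ[ℝ] ℝ :=
  g.toLinearMap ∘ₗ projPlus α δ₀ ∘ₗ intLin k

lemma intCoeff_sym (g : HPlus α δ₀ →ₐ[ℝ] ℝ) (k : MIdx) (τ : Sym) :
    intCoeff g k (H.sym τ) = g (projPlus α δ₀ (H.sym (Sym.int k τ))) := by
  simp [intCoeff, intLin_sym]

lemma vanishes_intCoeff (g : HPlus α δ₀ →ₐ[ℝ] ℝ) : Vanishes α δ₀ (intCoeff g) := by
  intro k τ h
  rw [intCoeff_sym, projPlus_sym_of_deg_nonpos, map_zero]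
  rw [Sym.deg_int]
  linarith

/-- The translation vector of `Γ_g`. -/
def translation (g : HPlus α δ₀ →ₐ[ℝ] ℝ) (i : Fin 4) : ℝ := g (XPlus α δ₀ i)

lemma evalRight_intTerm (g : HPlus α δ₀ →ₐ[ℝ] ℝ) (k : MIdx) (τ : Sym) (l m : MIdx) :
    evalRight g (intTerm α δ₀ k τ (l, m)) =
      (intCoeff g (k + l + m) (H.sym τ) • dpow (translation g) m) • dpow Xvec l := by
  rw [intTerm, evalRight_tmul, dpow_Xvec, map_mul, intCoeff_sym, map_smul, XpowPlus, map_prod,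
    smul_eq_mul, mul_comm]
  simp only [map_pow]
  rfl

lemma isRecentering_gamHom (g : HPlus α δ₀ →ₐ[ℝ] ℝ) :
    IsRecentering (translation g) (shift (translation g) (intCoeff g) (vanishes_intCoeff g))
      (gamHom g) where
  noise := by
    rw [gamHom, AlgHom.comp_apply, coprod_sym]
    change evalRight g (H.sym Sym.noise ⊗ₜ 1) = _
    rw [evalRight_tmul, map_one, one_smul]
  X i := by
    rw [gamHom, AlgHom.comp_apply, Xvec, coprod_sym]
    change evalRight g (H.sym (Sym.X i) ⊗ₜ 1 + 1 ⊗ₜ XPlus α δ₀ i) = _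
    rw [map_add, evalRight_tmul, evalRight_tmul, map_one, one_smul,
      Algebra.algebraMap_eq_smul_one]
    rfl
  C j := by
    rw [gamHom, AlgHom.comp_apply, coprod_sym]
    change evalRight g (H.sym (Sym.C j) ⊗ₜ 1) = _
    rw [evalRight_tmul, map_one, one_smul]
  int k τ := by
    have hfin := finite_support_intTerm α δ₀ k τ
    have hfin' : (Function.support fun p => evalRight g (intTerm α δ₀ k τ p)).Finite :=
      hfin.subset fun p hp h => hp (by simp only [h, map_zero])
    rw [gamHom, AlgHom.comp_apply, AlgHom.comp_apply, coprod_int, map_add, evalRight_rTensor,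
      map_finsum _ hfin, finsum_curry _ hfin']
    simp only [evalRight_intTerm, ← finsum_smul]
    rfl

lemma projPlus_sym {τ : Sym} (h : τ ∈ FPlus α δ₀) :
    projPlus α δ₀ (H.sym τ) = HPlus.sym ⟨τ, h⟩ := by
  simp [projPlus, H.sym, h]

lemma int_mem_FPlus {k : MIdx} {τ : Sym} (h : 0 < Sym.deg α δ₀ (Sym.int k τ)) :
    Sym.int k τ ∈ FPlus α δ₀ := by
  refine (Sym.isPlus_iff _ _ _).2 fun p hp => ?_
  rcases τ with ⟨a⟩
  rw [Multiset.mem_singleton.1 hp]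
  exact h

/-- The value on a formal expression of the multiplicative functional with the values `x i` on
`X_i` and `F k τ` on `I_k τ`; the value `0` on `Ξ` and `C_j` is an arbitrary choice. -/
def PreSym.value (x : Fin 4 → ℝ) (F : MIdx → Sym → ℝ) : PreSym → ℝ
  | .one => 1
  | .noise => 0
  | .X i => x i
  | .C _ => 0
  | .mul a b => a.value x F * b.value x F
  | .int k a => F k (Sym.mk a)

/-- The multiplicative functional on symbols with the values `x i` on `X_i` and `F k τ` on
`I_k τ`. -/
def Sym.value (x : Fin 4 → ℝ) (F : MIdx → Sym → ℝ) : Sym →* ℝ where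
  toFun := Quot.lift (PreSym.value x F) (by
    intro a b h
    induction h with
    | comm a b => simp only [PreSym.value, mul_comm]
    | assoc a b c => simp only [PreSym.value, mul_assoc]
    | one_mul a => simp only [PreSym.value, one_mul]
    | mul_left b _ ih => simp only [PreSym.value, ih]
    | mul_right a _ ih => simp only [PreSym.value, ih]
    | int k h ih =>
      simp only [PreSym.value]
      rw [show Sym.mk _ = Sym.mk _ from Quot.sound h])
  map_one' := rfl
  map_mul' := by rintro ⟨a⟩ ⟨b⟩; rfl

lemma Sym.value_int (x : Fin 4 → ℝ) (F : MIdx → Sym → ℝ) (k : MIdx) (τ : Sym) :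
    Sym.value x F (Sym.int k τ) = F k τ := by
  rcases τ with ⟨a⟩; rfl

/-- A multiplicative functional on `HPlus` can be prescribed freely on the `X_i` and on the `I_k τ`
with `|I_k τ| > 0`, which are irreducible. -/
lemma exists_character (x : Fin 4 → ℝ) (P : MIdx → H →ₗ[ℝ] ℝ) (hP : Vanishes α δ₀ P) :
    ∃ g : HPlus α δ₀ →ₐ[ℝ] ℝ, translation g = x ∧ intCoeff g = P := by
  let χ := Sym.value x fun k τ => P k (H.sym τ)
  let g : HPlus α δ₀ →ₐ[ℝ] ℝ :=
    MonoidAlgebra.lift ℝ ℝ (FPlus α δ₀) (χ.comp (FPlus α δ₀).subtype)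
  have hg : ∀ τ : FPlus α δ₀, g (HPlus.sym τ) = χ τ := fun τ => by
    simp [g, HPlus.sym]
  refine ⟨g, funext fun i => hg _, funext fun k => ext_sym fun τ => ?_⟩
  rw [intCoeff_sym]
  by_cases h : 0 < Sym.deg α δ₀ (Sym.int k τ)
  · rw [projPlus_sym (int_mem_FPlus h), hg]
    exact Sym.value_int _ _ k τ
  · rw [projPlus_sym_of_deg_nonpos _ _ _ _ (not_lt.1 h), map_zero, hP]
    rw [Sym.deg_int] at h
    linarith

/-- Every recentering map is some `Γ_g`. -/
lemma IsRecentering.exists_eq_gamHom {x : Fin 4 → ℝ} {P : MIdx → H →ₗ[ℝ] ℝ} {Γ : H →ₐ[ℝ] H}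
    (h : IsRecentering x P Γ) (hP : Vanishes α δ₀ P) :
    ∃ g : HPlus α δ₀ →ₐ[ℝ] ℝ, gamHom g = Γ := by
  obtain ⟨g, hx, hF⟩ := exists_character x (shift (-x) P hP) (vanishes_shift (-x) P hP)
  have hg := isRecentering_gamHom g
  rw [hx] at hg
  refine ⟨g, hg.unique h fun k τ => ?_⟩
  rw [shift_apply, hF, taylor_shift_neg]

/-- The operators `Γ_g` are stable under composition. -/
lemma exists_gamHom_comp (g h : HPlus α δ₀ →ₐ[ℝ] ℝ) :
    ∃ f : HPlus α δ₀ →ₐ[ℝ] ℝ, gamHom f = (gamHom g).comp (gamHom h) :=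
  ((isRecentering_gamHom g).comp (vanishes_shift _ _ _) (isRecentering_gamHom h)
    (vanishes_shift _ _ _)).exists_eq_gamHom
    (IsRecentering.vanishes_comp (vanishes_shift _ _ _) (isRecentering_gamHom h)
      (vanishes_shift _ _ _))

lemma exists_gamHom_eq_id : ∃ f : HPlus α δ₀ →ₐ[ℝ] ℝ, gamHom f = AlgHom.id ℝ H := by
  refine IsRecentering.exists_eq_gamHom (x := 0) (P := 0) ?_ fun k τ _ => rfl
  constructor <;> simp [taylor_zero_coeff, intLin_sym]

/-- The inverse of `Γ_g` on formal expressions. -/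
def PreSym.inverse (g : HPlus α δ₀ →ₐ[ℝ] ℝ) : PreSym → H
  | .one => 1
  | .noise => H.sym Sym.noise
  | .X i => Xvec i - algebraMap ℝ H (translation g i)
  | .C j => H.sym (Sym.C j)
  | .mul a b => a.inverse g * b.inverse g
  | .int k a => intLin k (a.inverse g) - taylor Xvec fun l => intCoeff g (k + l) (a.inverse g)

/-- The inverse of `Γ_g` on symbols. -/
def Sym.inverse (g : HPlus α δ₀ →ₐ[ℝ] ℝ) : Sym →* H where
  toFun := Quot.lift (PreSym.inverse g) (by
    intro a b h
    induction h with
    | comm a b => simp only [PreSym.inverse, mul_comm]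
    | assoc a b c => simp only [PreSym.inverse, mul_assoc]
    | one_mul a => simp only [PreSym.inverse, one_mul]
    | mul_left b _ ih => simp only [PreSym.inverse, ih]
    | mul_right a _ ih => simp only [PreSym.inverse, ih]
    | int k h ih => simp only [PreSym.inverse, ih])
  map_one' := rfl
  map_mul' := by rintro ⟨a⟩ ⟨b⟩; rfl

/-- The inverse of `Γ_g`. -/
def invHom (g : HPlus α δ₀ →ₐ[ℝ] ℝ) : H →ₐ[ℝ] H := MonoidAlgebra.lift ℝ H Sym (Sym.inverse g)

lemma invHom_sym (g : HPlus α δ₀ →ₐ[ℝ] ℝ) (τ : Sym) : invHom g (H.sym τ) = Sym.inverse g τ := by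
  simp [invHom, H.sym]

lemma invHom_int (g : HPlus α δ₀ →ₐ[ℝ] ℝ) (k : MIdx) (τ : Sym) :
    invHom g (H.sym (Sym.int k τ)) = intLin k (invHom g (H.sym τ)) -
      taylor Xvec fun l => intCoeff g (k + l) (invHom g (H.sym τ)) := by
  rw [invHom_sym, invHom_sym]
  rcases τ with ⟨a⟩; rfl

lemma isRecentering_invHom (g : HPlus α δ₀ →ₐ[ℝ] ℝ) :
    IsRecentering (-translation g) (fun k => -(intCoeff g k ∘ₗ (invHom g).toLinearMap))
      (invHom g) where
  noise := invHom_sym g _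
  X i := by
    rw [Pi.neg_apply, map_neg, ← sub_eq_add_neg]
    exact invHom_sym g _
  C j := invHom_sym g _
  int k τ := by
    simp only [invHom_int, LinearMap.neg_apply, LinearMap.comp_apply, AlgHom.toLinearMap_apply,
      taylor_neg_coeff, sub_eq_add_neg]

lemma vanishes_invHom (g : HPlus α δ₀ →ₐ[ℝ] ℝ) :
    Vanishes α δ₀ (fun k => -(intCoeff g k ∘ₗ (invHom g).toLinearMap)) := by
  have key : ∀ k τ, invHom g (H.sym τ) ∈ spanSym {σ | Sym.deg α δ₀ σ ≤ Sym.deg α δ₀ τ} →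
      Sym.deg α δ₀ τ + 2 ≤ wt k →
      (-(intCoeff g k ∘ₗ (invHom g).toLinearMap)) (H.sym τ) = 0 := fun k τ h hk => by
    simp [(vanishes_intCoeff g).apply_eq_zero h hk]
  exact fun k τ hk => key k τ (mem_spanSym_le ((isRecentering_invHom g).sub_mem_of key τ)) hk

lemma gamHom_comp_invHom (g : HPlus α δ₀ →ₐ[ℝ] ℝ) :
    (gamHom g).comp (invHom g) = AlgHom.id ℝ H := by
  have hg := isRecentering_gamHom g
  have hi := isRecentering_invHom g
  refine algHom_ext_sym fun τ => ?_
  simp only [AlgHom.comp_apply, AlgHom.id_apply]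
  induction τ using Sym.induction with
  | one => simp [H.sym_one]
  | noise => rw [hi.noise, hg.noise]
  | X i =>
    change gamHom g (invHom g (Xvec i)) = Xvec i
    rw [hi.X, map_add, hg.X, AlgHom.commutes, Pi.neg_apply, map_neg, add_neg_cancel_right]
  | C j => rw [hi.C, hg.C]
  | mul a b ha hb => rw [H.sym_mul, map_mul, map_mul, ha, hb]
  | int k a ha =>
    -- By Taylor's formula, `Γ_g` turns the correction in `invHom` into the one produced by `Γ_g`.
    have hfin := (vanishes_intCoeff g).finite_add k (invHom g (H.sym a))
    rw [invHom_int, map_sub, hg.intLin (vanishes_shift _ _ _), ha, map_taylor _ _ hfin]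
    simp only [hg.X]
    rw [taylor_add_left _ _ hfin, intLin_sym]
    simp only [shift_apply, add_assoc, add_sub_cancel_right]

/-- Every `Γ_g` has a right inverse of the same form. -/
lemma exists_gamHom_inverse (g : HPlus α δ₀ →ₐ[ℝ] ℝ) :
    ∃ h : HPlus α δ₀ →ₐ[ℝ] ℝ, (gamHom g).comp (gamHom h) = AlgHom.id ℝ H := by
  obtain ⟨h, hh⟩ := (isRecentering_invHom g).exists_eq_gamHom (vanishes_invHom g)
  exact ⟨h, hh ▸ gamHom_comp_invHom g⟩

lemma gamHom_sub_mem (g : HPlus α δ₀ →ₐ[ℝ] ℝ) (τ : Sym) :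
    gamHom g (H.sym τ) - H.sym τ ∈ spanSym {σ | Sym.deg α δ₀ σ < Sym.deg α δ₀ τ} :=
  (isRecentering_gamHom g).sub_mem (vanishes_shift _ _ _) τ

/-! ### Stability of the span of the symbols of the equation -/

lemma IsRecentering.map_dpow_Xvec {x : Fin 4 → ℝ} {P : MIdx → H →ₗ[ℝ] ℝ} {Γ : H →ₐ[ℝ] H}
    (h : IsRecentering x P Γ) (k : MIdx) : Γ (dpow Xvec k) ∈ spanSym UU := by
  rw [map_dpow]
  simp only [h.X]
  rw [show (fun i => Xvec i + algebraMap ℝ H (x i)) = Xvec + fun i => algebraMap ℝ H (x i) from rfl,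
    dpow_add]
  refine Submodule.sum_mem _ fun l _ => ?_
  have : dpow (fun i => algebraMap ℝ H (x i)) (k - l) = algebraMap ℝ H (dpow x (k - l)) :=
    (map_dpow (Algebra.ofId ℝ H) x (k - l)).symm
  rw [this, mul_comm, ← Algebra.smul_def, dpow_Xvec]
  exact Submodule.smul_mem _ _ (Submodule.smul_mem _ _ (sym_mem_spanSym (Xpow_mem_UU l)))

lemma mfact_ne_zero (k : MIdx) : mfact k ≠ 0 :=
  Finset.prod_ne_zero_iff.2 fun _ _ => Nat.cast_ne_zero.2 (Nat.factorial_ne_zero _)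

lemma IsRecentering.map_mem {x : Fin 4 → ℝ} {P : MIdx → H →ₗ[ℝ] ℝ} {Γ : H →ₐ[ℝ] H}
    (h : IsRecentering x P Γ) :
    (∀ w ∈ WW, Γ (H.sym w) ∈ spanSym WW) ∧ ∀ u ∈ UU, Γ (H.sym u) ∈ spanSym UU := by
  refine WW_induction ?_ ?_ ?_ ?_ ?_
  · rw [h.noise]
    exact sym_mem_spanSym noise_mem_WW
  · intro a _ b _ c _ ha hb hc
    rw [H.sym_mul, H.sym_mul, map_mul, map_mul]
    have hab := mul_mem_spanSym (fun a ha b hb => Set.mul_mem_mul ha hb) ha hb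
    refine mul_mem_spanSym ?_ hab hc
    rintro _ ⟨a, ha, b, hb, rfl⟩ c hc
    exact mul_mem_WW ha hb hc
  · intro k
    have : H.sym (Sym.Xpow k) = mfact k • dpow Xvec k := by
      rw [dpow_Xvec, smul_smul, mul_inv_cancel₀ (mfact_ne_zero k), one_smul]
    rw [this, map_smul]
    exact Submodule.smul_mem _ _ (h.map_dpow_Xvec k)
  · intro j
    rw [h.C]
    exact sym_mem_spanSym (C_mem_UU j)
  · intro w _ hw
    rw [h.int]
    refine add_mem (intLin_mem_spanSym (fun a ha => int_mem_UU ha) hw) (taylor_mem fun l _ => ?_)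
    rw [dpow_Xvec]
    exact Submodule.smul_mem _ _ (sym_mem_spanSym (Xpow_mem_UU l))

lemma gamHom_mem_HF (g : HPlus α δ₀ →ₐ[ℝ] ℝ) {v : H} (hv : v ∈ HF) : gamHom g v ∈ HF := by
  have : spanSym FF ≤ (spanSym FF).comap (gamHom g).toLinearMap := spanSym_le.2 fun τ hτ => by
    rw [FF_eq_WW] at hτ ⊢
    exact (isRecentering_gamHom g).map_mem.1 τ hτ
  exact this hv

/-! ### The grading -/

lemma mem_HF {v : H} : v ∈ HF ↔ ∀ τ, v.coeff τ ≠ 0 → τ ∈ FF := mem_spanSym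

lemma mem_TF {γ : AF α δ₀} {x : HF} :
    x ∈ TF α δ₀ γ ↔ ∀ τ, (x : H).coeff τ ≠ 0 → τ ∈ FF ∧ Sym.deg α δ₀ τ = γ :=
  mem_spanSym (S := {τ | τ ∈ FF ∧ Sym.deg α δ₀ τ = γ})

/-- A sum of the spaces `T_β` consists of the vectors whose symbols have the corresponding
homogeneities. -/
lemma mem_iSup_TF {p : AF α δ₀ → Prop} {x : HF} :
    x ∈ ⨆ (β : AF α δ₀) (_ : p β), TF α δ₀ β ↔
      ∀ τ, (x : H).coeff τ ≠ 0 → ∃ β, p β ∧ Sym.deg α δ₀ τ = β := by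
  constructor
  · intro hx
    have h : ⨆ (β : AF α δ₀) (_ : p β), TF α δ₀ β ≤
        (spanSym {τ | ∃ β, p β ∧ Sym.deg α δ₀ τ = β}).comap HF.subtype := by
      refine iSup₂_le fun β hβ y hy => ?_
      exact mem_spanSym.2 fun τ hτ => ⟨β, hβ, (mem_TF.1 hy τ hτ).2⟩
    exact mem_spanSym.1 (h hx)
  · intro hx
    have hF := mem_HF.1 x.2
    have hsum : x = ∑ τ ∈ (x : H).coeff.support.attach, (x : H).coeff τ •
        (⟨H.sym τ, sym_mem_spanSym (hF τ (Finsupp.mem_support_iff.1 τ.2))⟩ : HF) := by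
      apply Subtype.ext
      rw [AddSubmonoidClass.coe_finsetSum]
      simp only [SetLike.val_smul]
      rw [Finset.sum_attach _ fun τ => (x : H).coeff τ • H.sym τ]
      exact sum_coeff_sym (x : H)
    rw [hsum]
    refine Submodule.sum_mem _ fun τ _ => Submodule.smul_mem _ _ ?_
    have hτ := Finsupp.mem_support_iff.1 τ.2
    obtain ⟨β, hβ, hd⟩ := hx τ hτ
    refine Submodule.mem_iSup_of_mem β (Submodule.mem_iSup_of_mem hβ ?_)
    exact sym_mem_spanSym (S := {τ | τ ∈ FF ∧ Sym.deg α δ₀ τ = β}) ⟨hF τ hτ, hd⟩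

lemma isInternal_TF : letI := Classical.decEq (AF α δ₀); DirectSum.IsInternal (TF α δ₀) := by
  let _ := Classical.decEq (AF α δ₀)
  refine DirectSum.isInternal_submodule_of_iSupIndep_of_iSup_eq_top ?_ ?_
  · intro γ
    rw [Submodule.disjoint_def]
    intro x hx hx'
    apply Subtype.ext
    refine MonoidAlgebra.ext (Finsupp.ext fun τ => ?_)
    by_contra h
    obtain ⟨β, hβ, hd⟩ := mem_iSup_TF.1 hx' τ h
    exact hβ (Subtype.ext (hd.symm.trans (mem_TF.1 hx τ h).2))
  · refine eq_top_iff.2 fun x _ => ?_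
    have h : x ∈ ⨆ (β : AF α δ₀) (_ : True), TF α δ₀ β :=
      mem_iSup_TF.2 fun τ hτ => ⟨⟨_, τ, mem_HF.1 x.2 τ hτ, rfl⟩, trivial, rfl⟩
    simpa using h

lemma finiteDimensional_TF (hα : -18 / 7 < α) (hα' : α < -5 / 2) (hδ : 4 * α + 10 < -δ₀)
    (γ : AF α δ₀) : FiniteDimensional ℝ (TF α δ₀ γ) := by
  let S : Set Sym := {τ | τ ∈ FF ∧ Sym.deg α δ₀ τ = γ}
  have hS : S.Finite := (finite_deg_lt (δ₀ := δ₀) hα hα' hδ (γ + 1)).subset fun τ hτ =>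
    ⟨FF_eq_WW ▸ hτ.1, by rw [hτ.2]; linarith⟩
  have : FiniteDimensional ℝ (spanSym S) := FiniteDimensional.span_of_finite ℝ (hS.image _)
  let f : TF α δ₀ γ →ₗ[ℝ] spanSym S :=
    (HF.subtype ∘ₗ (TF α δ₀ γ).subtype).codRestrict (spanSym S) fun x => x.2
  exact Module.Finite.of_injective f fun x y h =>
    Subtype.ext (Subtype.ext (congrArg (fun z : spanSym S => (z : H)) h))

lemma normF_eq_zero (γ : AF α δ₀) (x : TF α δ₀ γ) (h : normF α δ₀ γ x = 0) : x = 0 := by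
  have h1 : ∑ τ ∈ ((x : HF) : H).coeff.support, |((x : HF) : H).coeff τ| = 0 := h
  rw [Finset.sum_eq_zero_iff_of_nonneg fun _ _ => abs_nonneg _] at h1
  apply Subtype.ext
  apply Subtype.ext
  refine MonoidAlgebra.ext (Finsupp.ext fun τ => ?_)
  by_contra hτ
  exact hτ (abs_eq_zero.1 (h1 τ (Finsupp.mem_support_iff.2 hτ)))

lemma TF_zero (hα : -18 / 7 < α) (hα' : α < -5 / 2) (hδ : 4 * α + 10 < -δ₀) (hδ' : -δ₀ < 0)
    (hne : 2 * δ₀ ≠ 3 * α + 8) (h0 : (0 : ℝ) ∈ AF α δ₀) :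
    TF α δ₀ ⟨0, h0⟩ = Submodule.span ℝ {oneF} := by
  apply le_antisymm
  · intro x hx
    refine Submodule.mem_span_singleton.2 ⟨(x : H).coeff 1, ?_⟩
    apply Subtype.ext
    refine MonoidAlgebra.ext (Finsupp.ext fun τ => ?_)
    change (x : H).coeff 1 * (H.sym 1).coeff τ = (x : H).coeff τ
    by_cases hτ : τ = 1
    · subst hτ; simp [H.sym]
    · have h1 : (x : H).coeff τ = 0 := by
        by_contra h
        obtain ⟨h2, h3⟩ := mem_TF.1 hx τ h
        exact hτ (eq_one_of_deg_eq_zero hα hα' hδ hδ' hne (FF_eq_WW ▸ h2) h3)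
      rw [h1, H.sym, MonoidAlgebra.coeff_single, Finsupp.single_eq_of_ne hτ, mul_zero]
  · rw [Submodule.span_singleton_le_iff_mem]
    exact sym_mem_spanSym (S := {τ | τ ∈ FF ∧ Sym.deg α δ₀ τ = 0}) ⟨one_mem_FF, rfl⟩

/-! ### The structure group -/

/-- The restriction of `Γ_g` to the span of the symbols of the equation. -/
def restrictHF (g : HPlus α δ₀ →ₐ[ℝ] ℝ) : Module.End ℝ HF :=
  (gamHom g).toLinearMap.restrict fun _ => gamHom_mem_HF g

lemma restrictHF_mem_GF (g : HPlus α δ₀ →ₐ[ℝ] ℝ) : restrictHF g ∈ GF α δ₀ :=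
  ⟨g, fun v => gamHom_apply g v⟩

lemma exists_eq_restrictHF {Φ : Module.End ℝ HF} (h : Φ ∈ GF α δ₀) :
    ∃ g : HPlus α δ₀ →ₐ[ℝ] ℝ, Φ = restrictHF g := by
  obtain ⟨g, hg⟩ := h
  exact ⟨g, LinearMap.ext fun v => Subtype.ext ((hg v).trans (gamHom_apply g v).symm)⟩

lemma restrictHF_mul (f g h : HPlus α δ₀ →ₐ[ℝ] ℝ) (hf : gamHom f = (gamHom g).comp (gamHom h)) :
    restrictHF g * restrictHF h = restrictHF f :=
  LinearMap.ext fun v => Subtype.ext (AlgHom.congr_fun hf v).symm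

lemma restrictHF_eq_one (f : HPlus α δ₀ →ₐ[ℝ] ℝ) (hf : gamHom f = AlgHom.id ℝ H) :
    restrictHF f = 1 :=
  LinearMap.ext fun v => Subtype.ext (AlgHom.congr_fun hf v)

lemma GF_mul_mem {Φ Ψ : Module.End ℝ HF} (hΦ : Φ ∈ GF α δ₀) (hΨ : Ψ ∈ GF α δ₀) :
    Φ * Ψ ∈ GF α δ₀ := by
  obtain ⟨g, rfl⟩ := exists_eq_restrictHF hΦ
  obtain ⟨h, rfl⟩ := exists_eq_restrictHF hΨ
  obtain ⟨f, hf⟩ := exists_gamHom_comp g h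
  rw [restrictHF_mul f g h hf]
  exact restrictHF_mem_GF f

lemma GF_one_mem : (1 : Module.End ℝ HF) ∈ GF α δ₀ := by
  obtain ⟨f, hf⟩ := exists_gamHom_eq_id (α := α) (δ₀ := δ₀)
  exact restrictHF_eq_one f hf ▸ restrictHF_mem_GF f

lemma GF_exists_mul_eq_one {Φ : Module.End ℝ HF} (hΦ : Φ ∈ GF α δ₀) :
    ∃ Ψ ∈ GF α δ₀, Φ * Ψ = 1 := by
  obtain ⟨g, rfl⟩ := exists_eq_restrictHF hΦ
  obtain ⟨h, hh⟩ := exists_gamHom_inverse g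
  exact ⟨_, restrictHF_mem_GF h, LinearMap.ext fun v => Subtype.ext (AlgHom.congr_fun hh v)⟩

lemma GF_exists_inverse {Φ : Module.End ℝ HF} (hΦ : Φ ∈ GF α δ₀) :
    ∃ Ψ ∈ GF α δ₀, Φ * Ψ = 1 ∧ Ψ * Φ = 1 := by
  obtain ⟨Ψ, hΨ, h1⟩ := GF_exists_mul_eq_one hΦ
  obtain ⟨Θ, -, h2⟩ := GF_exists_mul_eq_one hΨ
  have : Φ = Θ := by rw [← mul_one Φ, ← h2, ← mul_assoc, h1, one_mul]
  exact ⟨Ψ, hΨ, h1, this ▸ h2⟩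

lemma GF_triangular {Φ : Module.End ℝ HF} (hΦ : Φ ∈ GF α δ₀) (γ : AF α δ₀) (x : TF α δ₀ γ) :
    Φ x - x ∈ ⨆ (β : AF α δ₀) (_ : β < γ), TF α δ₀ β := by
  obtain ⟨g, rfl⟩ := exists_eq_restrictHF hΦ
  have h : spanSym {τ | τ ∈ FF ∧ Sym.deg α δ₀ τ = γ} ≤
      (spanSym {τ | Sym.deg α δ₀ τ < γ}).comap ((gamHom g).toLinearMap - LinearMap.id) :=
    spanSym_le.2 fun τ hτ => by
      have := gamHom_sub_mem g τ
      rw [hτ.2] at this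
      exact this
  refine mem_iSup_TF.2 fun τ hτ => ?_
  have hF : τ ∈ FF := mem_HF.1 (restrictHF g x - x).2 τ hτ
  exact ⟨⟨_, τ, hF, rfl⟩, mem_spanSym.1 (h x.2) τ hτ, rfl⟩

end PhiFour

end

theorem theorem3p1 (α δ₀ : ℝ) (hα : -18 / 7 < α) (hα' : α < -5 / 2)
    (hδ : 4 * α + 10 < -δ₀) (hδ' : -δ₀ < 0) (hne : 2 * δ₀ ≠ 3 * α + 8) :
    (∀ (g : PhiFour.HPlus α δ₀ →ₐ[ℝ] ℝ), ∀ v ∈ PhiFour.HF, PhiFour.Gam α δ₀ g v ∈ PhiFour.HF) ∧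
    (∀ γ : PhiFour.AF α δ₀, FiniteDimensional ℝ (PhiFour.TF α δ₀ γ)) ∧
    IsRegularityStructure (PhiFour.AF α δ₀) (PhiFour.TF α δ₀) (PhiFour.normF α δ₀)
      PhiFour.oneF (PhiFour.GF α δ₀) := by
  have hfin := PhiFour.finiteDimensional_TF (δ₀ := δ₀) hα hα' hδ
  refine ⟨fun g v hv => PhiFour.gamHom_apply g v ▸ PhiFour.gamHom_mem_HF g hv, hfin, ?_⟩
  have h0 : (0 : ℝ) ∈ PhiFour.AF α δ₀ := ⟨1, PhiFour.one_mem_FF, rfl⟩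
  exact
    { zero_mem := h0
      bddBelow := by
        refine ⟨α, ?_⟩
        rintro _ ⟨τ, hτ, rfl⟩
        exact (PhiFour.deg_lower_bound hα hα' hδ).1 τ (PhiFour.FF_eq_WW ▸ hτ)
      locallyFinite := fun R => by
        refine ((PhiFour.finite_deg_lt (δ₀ := δ₀) hα hα' hδ (R + 1)).image
          (PhiFour.Sym.deg α δ₀)).subset ?_
        rintro _ ⟨⟨τ, hτ, rfl⟩, hR⟩
        exact ⟨τ, ⟨PhiFour.FF_eq_WW ▸ hτ, by linarith [hR.2]⟩, rfl⟩
      internal := PhiFour.isInternal_TF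
      norm_definite := PhiFour.normF_eq_zero
      complete := fun γ u hu =>
        haveI := hfin γ
        Seminorm.exists_lim_of_finiteDimensional _ (PhiFour.normF_eq_zero γ) u hu
      one_ne_zero := fun h => by
        have h1 : PhiFour.H.sym 1 = 0 := congrArg Subtype.val h
        exact one_ne_zero (α := PhiFour.H) h1
      span_one := PhiFour.TF_zero hα hα' hδ hδ' hne h0
      id_mem := PhiFour.GF_one_mem
      mul_mem := fun _ hΦ _ hΨ => PhiFour.GF_mul_mem hΦ hΨ
      inv_mem := fun _ hΦ => PhiFour.GF_exists_inverse hΦ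
      continuous := fun Φ _ γ β =>
        haveI := hfin γ
        Seminorm.exists_le_mul_of_finiteDimensional _ (PhiFour.normF_eq_zero γ)
          (PhiFour.normF α δ₀ β)
          (gradedComponent PhiFour.isInternal_TF β ∘ₗ Φ ∘ₗ (PhiFour.TF α δ₀ γ).subtype)
      triangular := fun _ hΦ => PhiFour.GF_triangular hΦ
      map_one := fun Φ hΦ => by
        obtain ⟨g, rfl⟩ := PhiFour.exists_eq_restrictHF hΦ
        exact Subtype.ext (map_one (PhiFour.gamHom g)) }
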